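/- Let $K$ be an algebraically closed field of characteristic $0$ and let $X$ be a smooth irreducible quasi-projective variety of dimension $n$ over $K$, with sheaf of functions $\mathcal O$ and sheaf of vector fields $\Theta$. \emph{Charts.} An étale chart $(U,x)$ is an affine open $U\subset X$ with algebraically independent $x_1,\dots,x_n\in A=\mathcal O(U)$ such that $A$ is algebraic over $K[x_1,\dots,x_n]$ and the derivations $\partial/\partial x_i$ of $K[x_1,\dots,x_n]$ extend (necessarily uniquely) to $A$. For $f\in A$ put $f(x+X)=\sum_{s\in\mathbb Z_{\ge 0}^n}\frac1{s!}\frac{\partial^s f}{\partial x^s}X^s\in A[[X_1,\dots,X_n]]$. \emph{Jets.} For $U$ affine, $A=\mathcal O(U)$, $V=\Theta(U)$, let $A\# V=A\otimes_K V$ be the Lie algebra with bracket $[f\#\eta,g\#\mu]=f\eta(g)\#\mu-g\mu(f)\#\eta+fg\#[\eta,\mu]$. Let $\Delta$ be the kernel of the multiplication $A\otimes_K A\to A$, and let $A\widehat{\#}V$ be the completion of $A\# V$ with respect to the ideals $\Delta^m(A\#V)$, where $(a\otimes b)(f\#\eta)=af\#b\eta$. The anchor map $A\widehat\# V\to V$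 extends $g\#\eta\mapsto g\eta$; its kernel is the Lie algebra $\mathcal L_+(U)$ (over $A$) of virtual jets. In a chart, a series $F=\sum_s F_sX^s\in A[[X]]$ without constant term defines the virtual jet $F\,\partial/\partial X_j=\sum_s F_s\,(1\otimes x-x\otimes 1)^s\,(1\#\partial/\partial x_j)$; in this way $\mathcal L_+(U)$ is the completed tensor product of $A$ with the Lie algebra $\widehat L_+$ of derivations of $K[[X_1,\dots,X_n]]$ vanishing at $0$. \emph{The sheaf $\mathcal{AV}$.} On an étale chart $U$ the completion $A\widehat\# U(V)$ is the strong enveloping algebra of the Lie–Rinehart pair $(A,A\widehat\# V)$, that is, the quotient of $A\# U(A\widehat\# V)$ by the ideal generated by the elements $f\#\xi-1\#f\xi$ with $f\in A$, $\xi\in A\widehat\# V$. These algebras glue to a sheaf $\mathcal{AV}$ of associative algebras on $X$. \emph{Charged $\mathcal D$-modules.} An $\mathcal L_+$-charged sheaf of $\mathcal D$-modules is a sheaf $\mathcal M$ of $\mathcal O$-modules with an $\mathcal O$-linear morphism of sheaves of Lie algebras $\mathcal L_+\to\mathcal{E}nd_{\mathcal O}(\mathcal M)$ and, for each étale chart $(U,x)$,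 a module structure on $\mathcal M(U)$ over the algebra $\mathcal D(U)$ of differential operators, extending that over $\mathcal O(U)$, such that (1) $\left[\frac{\partial}{\partial x_i},F\frac{\partial}{\partial X_j}\right]=\frac{\partial F}{\partial x_i}\frac{\partial}{\partial X_j}$ on $\mathcal M(U)$ for every $F\in A[[X]]$ without constant term, where $\partial/\partial x_i$ acts on the coefficients of $F$; (2) if $(U,x)$ and $(W,y)$ are étale charts with $W\subset U$, then for $m\in\mathcal M(U)$ $$\Big(\frac{\partial}{\partial x_i}m\Big)\Big|_W=\sum_{j=1}^n\Big(h_j\frac{\partial}{\partial y_j}+\big(h_j(y+Y)-h_j(y)\big)\frac{\partial}{\partial Y_j}\Big)\,m|_W,\qquad h_j=\frac{\partial y_j}{\partial x_i}.$$ \textbf{Theorem.} Every $\mathcal L_+$-charged sheaf $\mathcal M$ of $\mathcal D$-modules on $X$ has a structure of a sheaf of modules over $\mathcal{AV}$, extending the actions of $\mathcal O$ and of $\mathcal L_+$, in which the vector field $f\,\partial/\partial x_i$ (the element $1\# f\,\partial/\partial x_i$) acts, in every étale chart $(U,x)$ and for every $f\in\mathcal O(U)$, by $$\rho\Big(f\frac{\partial}{\partial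 x_i}\Big)=f\frac{\partial}{\partial x_i}+\big(f(x+X)-f(x)\big)\frac{\partial}{\partial X_i}.$$ -/

import Mathlib

set_option linter.unusedSectionVars false

universe u v w

open TensorProduct AlgebraicGeometry CategoryTheory

noncomputable section

namespace AVSheaf

section Algebra

variable (K : Type u) (A : Type v) (V : Type w) [CommRing K] [CommRing A] [Algebra K A]
  [LieRing V] [LieAlgebra K V] [Module A V] [LieRingModule V A]

/-- The space `A # V = A ⊗ V`; its bracket is not the one of the extension of scalars, hence a
type synonym. -/
def Smash : Type (max v w) := A ⊗[K] V

namespace Smash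

instance : AddCommGroup (Smash K A V) := inferInstanceAs (AddCommGroup (A ⊗[K] V))
instance : Module K (Smash K A V) := inferInstanceAs (Module K (A ⊗[K] V))
instance : Module A (Smash K A V) := inferInstanceAs (Module A (A ⊗[K] V))
instance : IsScalarTower K A (Smash K A V) := inferInstanceAs (IsScalarTower K A (A ⊗[K] V))

variable {A V}

/-- The element `f # η`. -/
def mk (f : A) (η : V) : Smash K A V := f ⊗ₜ[K] η

variable {K}

theorem induction {p : Smash K A V → Prop} (x : Smash K A V) (h0 : p 0)
    (h1 : ∀ f η, p (mk K f η)) (h2 : ∀ x y, p x → p y → p (x + y)) : p x :=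
  TensorProduct.induction_on x h0 h1 h2

theorem mk_add (f : A) (η μ : V) : mk K f (η + μ) = mk K f η + mk K f μ :=
  TensorProduct.tmul_add _ _ _
theorem add_mk (f g : A) (η : V) : mk K (f + g) η = mk K f η + mk K g η :=
  TensorProduct.add_tmul _ _ _
theorem sub_mk (f g : A) (η : V) : mk K (f - g) η = mk K f η - mk K g η :=
  TensorProduct.sub_tmul _ _ _
theorem smul_mk (a f : A) (η : V) : a • mk K f η = mk K (a * f) η := rfl

variable [LieRinehartRing A V] [LieRinehartAlgebra K A V]

variable (K A V) in
/-- `(f # η, g # μ) ↦ f η(g) # μ`. -/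
def nablaAux : A ⊗[K] V →ₗ[K] A ⊗[K] V →ₗ[K] A ⊗[K] V :=
  TensorProduct.lift <| LinearMap.mk₂ K
    (fun (f : A) (η : V) => (TensorProduct.map
      (LinearMap.mulLeft K f ∘ₗ (LieModule.toEnd K V A η)) LinearMap.id :
        A ⊗[K] V →ₗ[K] A ⊗[K] V))
    (by intros; apply TensorProduct.ext'; intros; simp [add_mul, TensorProduct.add_tmul])
    (by intros; apply TensorProduct.ext'; intros; simp [TensorProduct.smul_tmul'])
    (by intros; apply TensorProduct.ext'; intros; simp [mul_add, TensorProduct.add_tmul])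
    (by intros; apply TensorProduct.ext'; intros; simp [TensorProduct.smul_tmul'])

variable (K A V) in
/-- `(f # η, g # μ) ↦ f g # [η, μ]`. -/
def scalarBracketAux : A ⊗[K] V →ₗ[K] A ⊗[K] V →ₗ[K] A ⊗[K] V :=
  TensorProduct.lift <| LinearMap.mk₂ K
    (fun (f : A) (η : V) => (TensorProduct.map
      (LinearMap.mulLeft K f) (LieModule.toEnd K V V η) : A ⊗[K] V →ₗ[K] A ⊗[K] V))
    (by intros; apply TensorProduct.ext'; intros; simp [add_mul, TensorProduct.add_tmul])
    (by intros; apply TensorProduct.ext'; intros; simp [TensorProduct.smul_tmul'])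
    (by intros; apply TensorProduct.ext'; intros; simp [TensorProduct.tmul_add])
    (by intros; apply TensorProduct.ext'; intros; simp)

variable (K A V) in
/-- `(f # η, g # μ) ↦ f η(g) # μ`. -/
def nabla : Smash K A V →ₗ[K] Smash K A V →ₗ[K] Smash K A V := nablaAux K A V

variable (K A V) in
/-- `(f # η, g # μ) ↦ f g # [η, μ]`. -/
def scalarBracket : Smash K A V →ₗ[K] Smash K A V →ₗ[K] Smash K A V := scalarBracketAux K A V

/-- The bracket `[f # η, g # μ] = f η(g) # μ - g μ(f) # η + f g # [η, μ]`. -/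
instance : Bracket (Smash K A V) (Smash K A V) :=
  ⟨fun x y => nabla K A V x y - nabla K A V y x + scalarBracket K A V x y⟩

theorem mk_lie_mk (f g : A) (η μ : V) : ⁅mk K f η, mk K g μ⁆ =
    mk K (f * ⁅η, g⁆) μ - mk K (g * ⁅μ, f⁆) η + mk K (f * g) ⁅η, μ⁆ := rfl

theorem lie_def (x y : Smash K A V) :
    ⁅x, y⁆ = nabla K A V x y - nabla K A V y x + scalarBracket K A V x y := rfl

theorem add_lie' (x y z : Smash K A V) : ⁅x + y, z⁆ = ⁅x, z⁆ + ⁅y, z⁆ := by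
  simp only [lie_def, map_add, LinearMap.add_apply]; abel

theorem lie_add' (x y z : Smash K A V) : ⁅x, y + z⁆ = ⁅x, y⁆ + ⁅x, z⁆ := by
  simp only [lie_def, map_add, LinearMap.add_apply]; abel

theorem zero_lie' (x : Smash K A V) : ⁅(0 : Smash K A V), x⁆ = 0 := by
  simp [lie_def]

theorem lie_zero' (x : Smash K A V) : ⁅x, (0 : Smash K A V)⁆ = 0 := by
  simp [lie_def]

theorem lie_antisymm (x y : Smash K A V) : ⁅x, y⁆ = - ⁅y, x⁆ := by
  induction x using Smash.induction with
  | h0 => simp [zero_lie', lie_zero']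
  | h2 x x' h h' => rw [add_lie', lie_add', h, h']; abel
  | h1 f η =>
    induction y using Smash.induction with
    | h0 => simp [zero_lie', lie_zero']
    | h2 x x' h h' => rw [add_lie', lie_add', h, h']; abel
    | h1 g μ =>
      rw [mk_lie_mk, mk_lie_mk, ← lie_skew η μ, mul_comm g f]
      have : mk K (f * g) (-⁅μ, η⁆) = - mk K (f * g) ⁅μ, η⁆ := TensorProduct.tmul_neg _ _
      rw [this]; abel

theorem lie_self' (x : Smash K A V) : ⁅x, x⁆ = 0 := by
  induction x using Smash.induction with
  | h0 => simp [zero_lie']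
  | h2 x y h h' => rw [add_lie', lie_add', lie_add', h, h', lie_antisymm x y]; abel
  | h1 f η => rw [mk_lie_mk, lie_self, sub_self, zero_add]; exact TensorProduct.tmul_zero _ _

theorem jacobi (x y z : Smash K A V) : ⁅x, ⁅y, z⁆⁆ = ⁅⁅x, y⁆, z⁆ + ⁅y, ⁅x, z⁆⁆ := by
  induction x using Smash.induction with
  | h0 => simp [zero_lie', lie_zero']
  | h2 x x' h h' => simp only [add_lie', lie_add', h, h']; abel
  | h1 f η =>
  induction y using Smash.induction with
  | h0 => simp [zero_lie', lie_zero']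
  | h2 x x' h h' => simp only [add_lie', lie_add', h, h']; abel
  | h1 g μ =>
  induction z using Smash.induction with
  | h0 => simp [lie_zero']
  | h2 x x' h h' => simp only [lie_add', h, h']; abel
  | h1 k ν =>
    have hs (x y z : Smash K A V) : ⁅x, y - z⁆ = ⁅x, y⁆ - ⁅x, z⁆ := by
      simp only [lie_def, map_sub, LinearMap.sub_apply]; abel
    have hs' (x y z : Smash K A V) : ⁅x - y, z⁆ = ⁅x, z⁆ - ⁅y, z⁆ := by
      simp only [lie_def, map_sub, LinearMap.sub_apply]; abel
    have hn (f : A) (η : V) : mk K f (-η) = - mk K f η := TensorProduct.tmul_neg _ _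
    have hA (η μ : V) (a : A) : ⁅⁅η, μ⁆, a⁆ = ⁅η, ⁅μ, a⁆⁆ - ⁅μ, ⁅η, a⁆⁆ := lie_lie _ _ _
    have e3 : ⁅μ, η⁆ = -⁅η, μ⁆ := (lie_skew _ _).symm
    simp only [mk_lie_mk, hs, hs', add_lie', lie_add', LieRinehartRing.leibniz_mul_right,
      smul_eq_mul, hA, mul_add, mul_sub, add_mk, sub_mk, e3, hn, leibniz_lie η μ ν, mk_add]
    ring_nf
    abel

instance : LieRing (Smash K A V) where
  add_lie := add_lie'
  lie_add := lie_add'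
  lie_self := lie_self'
  leibniz_lie := jacobi

instance : LieAlgebra K (Smash K A V) where
  lie_smul r x y := by simp only [lie_def, map_smul, LinearMap.smul_apply, smul_sub, smul_add]

/-- `A # V` is an `A ⊗ A`-module by `(a ⊗ b) (f # η) = a f # b η`. -/
instance : Module (A ⊗[K] A) (Smash K A V) :=
  Module.compHom (A ⊗[K] V) ((Module.endTensorEndAlgHom (R := K) (S := K) (A := K)
    (M := A) (N := V)).comp (Algebra.TensorProduct.map (Algebra.lsmul K K A)
    (Algebra.lsmul K K V))).toRingHom

theorem tmul_smul_mk (a b f : A) (η : V) :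
    (a ⊗ₜ[K] b) • mk K f η = mk K (a * f) (b • η) := rfl

theorem includeLeft_smul (a : A) (x : Smash K A V) : (a ⊗ₜ[K] (1 : A)) • x = a • x := by
  induction x using Smash.induction with
  | h0 => simp
  | h1 f η => rw [tmul_smul_mk, one_smul, smul_mk]
  | h2 x y h h' => rw [smul_add, smul_add, h, h']

instance : IsScalarTower A (A ⊗[K] A) (Smash K A V) where
  smul_assoc a s x := by
    have : a • s = (a ⊗ₜ[K] (1 : A)) * s := by rw [Algebra.smul_def]; rfl
    rw [this, mul_smul, includeLeft_smul]

instance : IsScalarTower K (A ⊗[K] A) (Smash K A V) where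
  smul_assoc a s x := by
    rw [← algebraMap_smul A a s, ← algebraMap_smul A a (s • x), smul_assoc]

variable (K A V) in
/-- The anchor `f # η ↦ f η`. -/
def anchor : Smash K A V →ₗ[A] V :=
  TensorProduct.AlgebraTensorModule.lift ((LinearMap.lsmul A V).restrictScalars₁₂ A K)

theorem anchor_mk (f : A) (η : V) : anchor K A V (mk K f η) = f • η := rfl

theorem anchor_smul (c : A ⊗[K] A) (x : Smash K A V) :
    anchor K A V (c • x) = Algebra.TensorProduct.lmul' K c • anchor K A V x := by
  induction x using Smash.induction with
  | h0 => simp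
  | h2 x y h h' => rw [smul_add, map_add, h, h', map_add, smul_add]
  | h1 f η =>
    induction c using TensorProduct.induction_on with
    | zero => simp
    | add x y h h' => rw [add_smul, map_add, h, h', map_add, add_smul]
    | tmul a b =>
      rw [tmul_smul_mk, anchor_mk, anchor_mk, Algebra.TensorProduct.lmul'_apply_tmul,
        smul_smul, smul_smul]
      congr 1; ring

theorem smul_lie_smul (f g : A) (η μ : V) : ⁅f • η, g • μ⁆ =
    (f * ⁅η, g⁆) • μ - (g * ⁅μ, f⁆) • η + (f * g) • ⁅η, μ⁆ := by
  rw [LieRinehartRing.leibniz_smul_right, LieRinehartRing.lie_smul_eq_mul,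
    ← lie_skew (f • η) μ, LieRinehartRing.leibniz_smul_right, ← lie_skew η μ]
  module

theorem anchor_lie (x y : Smash K A V) :
    anchor K A V ⁅x, y⁆ = ⁅anchor K A V x, anchor K A V y⁆ := by
  induction x using Smash.induction with
  | h0 => simp
  | h2 x x' h h' => simp only [add_lie, map_add, h, h']
  | h1 f η =>
  induction y using Smash.induction with
  | h0 => simp
  | h2 x x' h h' => simp only [lie_add, map_add, h, h']
  | h1 g μ =>
    simp only [mk_lie_mk, map_add, map_sub, anchor_mk, smul_lie_smul]

theorem lie_smul_right (x y : Smash K A V) (a : A) :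
    ⁅x, a • y⁆ = a • ⁅x, y⁆ + ⁅anchor K A V x, a⁆ • y := by
  induction x using Smash.induction with
  | h0 => simp
  | h2 x x' h h' => simp only [add_lie, map_add, h, h', smul_add, add_smul]; abel
  | h1 f η =>
  induction y using Smash.induction with
  | h0 => simp
  | h2 x x' h h' => simp only [lie_add, h, h', smul_add]; abel
  | h1 g μ =>
    simp only [smul_mk, mk_lie_mk, anchor_mk, LieRinehartRing.lie_smul_eq_mul,
      LieRinehartRing.leibniz_mul_right, mul_add, add_mk, smul_add, smul_sub, smul_eq_mul]
    ring_nf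
    abel

/-- The derivation `η ⊗ 1 + 1 ⊗ η` of `A ⊗ A`. -/
def diag (η : V) : A ⊗[K] A →ₗ[K] A ⊗[K] A :=
  TensorProduct.map (LieModule.toEnd K V A η) LinearMap.id +
    TensorProduct.map LinearMap.id (LieModule.toEnd K V A η)

theorem diag_tmul (η : V) (a b : A) :
    diag (K := K) η (a ⊗ₜ b) = ⁅η, a⁆ ⊗ₜ b + a ⊗ₜ ⁅η, b⁆ := rfl

theorem diag_mul (η : V) (c d : A ⊗[K] A) :
    diag η (c * d) = c * diag η d + diag η c * d := by
  induction c using TensorProduct.induction_on with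
  | zero => simp
  | add x y h h' => simp only [add_mul, map_add, h, h']; ring
  | tmul a b =>
  induction d using TensorProduct.induction_on with
  | zero => simp
  | add x y h h' => simp only [mul_add, map_add, h, h']; ring
  | tmul a' b' =>
    simp only [Algebra.TensorProduct.tmul_mul_tmul, diag_tmul, mul_add, add_mul,
      LieRinehartRing.leibniz_mul_right, smul_eq_mul, TensorProduct.add_tmul,
      TensorProduct.tmul_add]
    abel

theorem lmul_diag (η : V) (c : A ⊗[K] A) :
    Algebra.TensorProduct.lmul' K (diag η c) = ⁅η, Algebra.TensorProduct.lmul' K c⁆ := by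
  induction c using TensorProduct.induction_on with
  | zero => simp
  | add x y h h' => simp only [map_add, lie_add, h, h']
  | tmul a b => simp [diag_tmul, add_comm]

theorem diag_mem (η : V) (m : ℕ) {c : A ⊗[K] A}
    (hc : c ∈ KaehlerDifferential.ideal K A ^ m) :
    diag η c ∈ KaehlerDifferential.ideal K A ^ m := by
  induction m generalizing c with
  | zero => simp
  | succ m ih =>
    rw [pow_succ] at hc ⊢
    induction hc using Submodule.mul_induction_on' with
    | mem_mul_mem a ha b hb =>
      rw [diag_mul]
      refine add_mem (Ideal.mul_mem_mul ha ?_) (Ideal.mul_mem_mul (ih ha) hb)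
      rw [RingHom.mem_ker] at hb ⊢
      exact (lmul_diag η b).trans (by simp [show Algebra.TensorProduct.lmul' K b = 0 from hb])
    | add x hx y hy h h' => rw [map_add]; exact add_mem h h'

theorem mk_lie_smul (f : A) (η : V) (c : A ⊗[K] A) (y : Smash K A V) :
    ⁅mk K f η, c • y⁆ = ((f ⊗ₜ[K] (1 : A)) * diag η c) • y + c • ⁅mk K f η, y⁆
      + c • nabla K A V y (mk K f η)
      - Algebra.TensorProduct.lmul' K c • nabla K A V y (mk K f η) := by
  induction y using Smash.induction with
  | h0 => simp
  | h2 x x' h h' =>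
    simp only [lie_add, h, h', smul_add, map_add, LinearMap.add_apply]; abel
  | h1 g μ =>
  induction c using TensorProduct.induction_on with
  | zero => simp
  | add x y h h' => simp only [add_smul, lie_add, h, h', map_add, mul_add]; abel
  | tmul a b =>
    have hn : nabla K A V (mk K g μ) (mk K f η) = mk K (g * ⁅μ, f⁆) η := rfl
    simp only [hn, diag_tmul, mul_add, add_smul, Algebra.TensorProduct.tmul_mul_tmul, one_mul,
      tmul_smul_mk, mk_lie_mk, smul_add, smul_sub, LieRinehartRing.leibniz_smul_right, mk_add,
      LieRinehartRing.lie_smul_eq_mul, LieRinehartRing.leibniz_mul_right,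
      Algebra.TensorProduct.lmul'_apply_tmul, smul_mk, smul_eq_mul, add_mk]
    ring_nf
    abel

variable (K A V) in
/-- The subspace `Δ ^ m (A # V)`, where `Δ` is the kernel of `A ⊗ A → A`. -/
abbrev filtration (m : ℕ) : Submodule (A ⊗[K] A) (Smash K A V) :=
  KaehlerDifferential.ideal K A ^ m • ⊤

theorem lie_mem_right (m : ℕ) (x : Smash K A V) {y : Smash K A V}
    (hy : y ∈ filtration K A V m) : ⁅x, y⁆ ∈ filtration K A V m := by
  rcases Nat.eq_zero_or_pos m with rfl | hm
  · simp [filtration]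
  induction x using Smash.induction with
  | h0 => simp
  | h2 x x' h h' => rw [add_lie]; exact add_mem h h'
  | h1 f η =>
  induction hy using Submodule.smul_induction_on' with
  | smul c hc y hy =>
    have h0 : Algebra.TensorProduct.lmul' K c = 0 :=
      Ideal.pow_le_self hm.ne' hc
    rw [mk_lie_smul, h0, zero_smul, sub_zero]
    refine add_mem (add_mem ?_ ?_) ?_
    · exact Submodule.smul_mem_smul (Ideal.mul_mem_left _ _ (diag_mem η m hc)) trivial
    · exact Submodule.smul_mem_smul hc trivial
    · exact Submodule.smul_mem_smul hc trivial
  | add x hx y hy h h' => rw [lie_add]; exact add_mem h h'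

theorem lie_mem_left (m : ℕ) {x : Smash K A V} (y : Smash K A V)
    (hx : x ∈ filtration K A V m) : ⁅x, y⁆ ∈ filtration K A V m := by
  rw [← lie_skew]; exact neg_mem (lie_mem_right m y hx)

/-- The bracket of `(A # V) / Δ ^ m (A # V)`. -/
def quotBracket (m : ℕ) (x y : Smash K A V ⧸ filtration K A V m) :
    Smash K A V ⧸ filtration K A V m :=
  Quotient.map₂ (fun a b => ⁅a, b⁆) (by
    intro a a' h b b' h'
    replace h := (Submodule.quotientRel_def _).1 h
    replace h' := (Submodule.quotientRel_def _).1 h'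
    refine (Submodule.quotientRel_def _).2 ?_
    have : ⁅a, b⁆ - ⁅a', b'⁆ = ⁅a - a', b⁆ + ⁅a', b - b'⁆ := by
      rw [sub_lie, lie_sub]; abel
    rw [this]
    exact add_mem (lie_mem_left m _ h) (lie_mem_right m _ h')) x y

theorem quotBracket_mk (m : ℕ) (x y : Smash K A V) :
    quotBracket m (Submodule.Quotient.mk x) (Submodule.Quotient.mk y) =
      Submodule.Quotient.mk ⁅x, y⁆ := rfl

end Smash

variable [LieRinehartRing A V] [LieRinehartAlgebra K A V]

/-- The completion of `A # V` in the topology given by the ideals `Δ ^ m (A # V)`: the jets of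
vector fields when `V` is the Lie algebra of vector fields. -/
abbrev Jet : Type (max v w) := AdicCompletion (KaehlerDifferential.ideal K A) (Smash K A V)

namespace Jet

variable {K A V}

theorem exists_rep (x : Jet K A V) (m : ℕ) :
    ∃ a : Smash K A V, x.val m = Submodule.Quotient.mk a := by
  obtain ⟨a, ha⟩ := Submodule.Quotient.mk_surjective _ (x.val m)
  exact ⟨a, ha.symm⟩

theorem rep_of_le (x : Jet K A V) {m m' : ℕ} (h : m ≤ m') {a : Smash K A V}
    (ha : x.val m' = Submodule.Quotient.mk a) : x.val m = Submodule.Quotient.mk a :=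
  (x.2 h).symm.trans (congrArg _ ha)

/-- The bracket, level by level. -/
instance : Bracket (Jet K A V) (Jet K A V) where
  bracket x y := ⟨fun m => Smash.quotBracket m (x.val m) (y.val m), by
    intro m m' h
    obtain ⟨a, ha⟩ := exists_rep x m'
    obtain ⟨b, hb⟩ := exists_rep y m'
    beta_reduce
    rw [ha, hb, rep_of_le x h ha, rep_of_le y h hb]
    rfl⟩

theorem lie_val (x y : Jet K A V) (m : ℕ) :
    ⁅x, y⁆.val m = Smash.quotBracket m (x.val m) (y.val m) := rfl

instance : LieRing (Jet K A V) where
  add_lie x y z := by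
    ext m
    obtain ⟨a, ha⟩ := exists_rep x m
    obtain ⟨b, hb⟩ := exists_rep y m
    obtain ⟨c, hc⟩ := exists_rep z m
    simp only [lie_val, AdicCompletion.val_add_apply, ha, hb, hc, Smash.quotBracket_mk,
      ← Submodule.Quotient.mk_add, add_lie]
  lie_add x y z := by
    ext m
    obtain ⟨a, ha⟩ := exists_rep x m
    obtain ⟨b, hb⟩ := exists_rep y m
    obtain ⟨c, hc⟩ := exists_rep z m
    simp only [lie_val, AdicCompletion.val_add_apply, ha, hb, hc, Smash.quotBracket_mk,
      ← Submodule.Quotient.mk_add, lie_add]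
  lie_self x := by
    ext m
    obtain ⟨a, ha⟩ := exists_rep x m
    simp only [lie_val, ha, Smash.quotBracket_mk, lie_self]
    rfl
  leibniz_lie x y z := by
    ext m
    obtain ⟨a, ha⟩ := exists_rep x m
    obtain ⟨b, hb⟩ := exists_rep y m
    obtain ⟨c, hc⟩ := exists_rep z m
    simp only [lie_val, AdicCompletion.val_add_apply, ha, hb, hc, Smash.quotBracket_mk,
      ← Submodule.Quotient.mk_add]
    rw [leibniz_lie]

instance : LieAlgebra K (Jet K A V) where
  lie_smul r x y := by
    ext m
    obtain ⟨a, ha⟩ := exists_rep x m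
    obtain ⟨b, hb⟩ := exists_rep y m
    simp only [lie_val, AdicCompletion.val_smul_apply, ha, hb, Smash.quotBracket_mk,
      ← Submodule.Quotient.mk_smul, lie_smul]

variable (K A V) in
/-- The anchor map kills `Δ (A # V)`. -/
def anchorQuot : (Smash K A V ⧸ Smash.filtration K A V 1) →ₗ[A] V :=
  (((Smash.filtration K A V 1).restrictScalars A).liftQ (Smash.anchor K A V) (by
    intro x hx
    rw [Submodule.restrictScalars_mem] at hx
    rw [LinearMap.mem_ker]
    induction hx using Submodule.smul_induction_on' with
    | smul c hc y hy =>
      rw [pow_one] at hc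
      rw [Smash.anchor_smul, show Algebra.TensorProduct.lmul' K c = 0 from hc, zero_smul]
    | add x hx y hy h h' => rw [map_add, h, h', add_zero])) ∘ₗ
    (Submodule.Quotient.restrictScalarsEquiv A (Smash.filtration K A V 1)).symm.toLinearMap

variable (K A V) in
/-- The anchor map `g # η ↦ g η`, extended to the completion. -/
def anchor : Jet K A V →ₗ[A] V :=
  anchorQuot K A V ∘ₗ (AdicCompletion.eval _ (Smash K A V) 1).restrictScalars A

theorem anchor_eq (x : Jet K A V) {m : ℕ} (hm : 0 < m) {a : Smash K A V}
    (ha : x.val m = Submodule.Quotient.mk a) : anchor K A V x = Smash.anchor K A V a :=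
  congrArg (anchorQuot K A V) (rep_of_le x (Nat.succ_le_of_lt hm) ha)

theorem anchor_lie (x y : Jet K A V) : anchor K A V ⁅x, y⁆ = ⁅anchor K A V x, anchor K A V y⁆ := by
  obtain ⟨a, ha⟩ := exists_rep x 1
  obtain ⟨b, hb⟩ := exists_rep y 1
  rw [anchor_eq x one_pos ha, anchor_eq y one_pos hb, ← Smash.anchor_lie]
  exact anchor_eq _ one_pos (by rw [lie_val, ha, hb, Smash.quotBracket_mk])

/-- Jets of vector fields act on functions through the anchor. -/
instance : LieRingModule (Jet K A V) A where
  bracket x a := ⁅anchor K A V x, a⁆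
  add_lie x y a := by change ⁅anchor K A V (x + y), a⁆ = _; rw [map_add, add_lie]
  lie_add x a b := lie_add _ _ _
  leibniz_lie x y a := by
    change _ = ⁅anchor K A V ⁅x, y⁆, a⁆ + _
    rw [anchor_lie]
    exact leibniz_lie _ _ _

theorem lie_apply (x : Jet K A V) (a : A) : ⁅x, a⁆ = ⁅anchor K A V x, a⁆ := rfl

instance : LieRinehartRing A (Jet K A V) where
  lie_smul_eq_mul' a b x := by
    rw [lie_apply, lie_apply, map_smul, LieRinehartRing.lie_smul_eq_mul]
  leibniz_mul_right' x a b := by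
    simp only [lie_apply, LieRinehartRing.leibniz_mul_right]
  leibniz_smul_right' x y a := by
    ext m
    rcases Nat.eq_zero_or_pos m with rfl | hm
    · have : Subsingleton (Smash K A V ⧸ Smash.filtration K A V 0) := by
        rw [Submodule.Quotient.subsingleton_iff]; simp [Smash.filtration]
      exact Subsingleton.elim _ _
    obtain ⟨b, hb⟩ := exists_rep x m
    obtain ⟨c, hc⟩ := exists_rep y m
    simp only [lie_val, AdicCompletion.val_add_apply, AdicCompletion.val_smul_apply, hb, hc,
      lie_apply, anchor_eq x hm hb, Smash.quotBracket_mk, ← Submodule.Quotient.mk_smul,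
      ← Submodule.Quotient.mk_add, Smash.lie_smul_right]

instance : LieRinehartAlgebra K A (Jet K A V) where
  smul_lie r x a := by
    rw [lie_apply, lie_apply, ← algebraMap_smul A r x, map_smul, LieRinehartRing.lie_smul_eq_mul,
      Algebra.smul_def]
  lie_smul r x a := by rw [lie_apply, lie_apply, lie_smul]

variable (K A V) in
/-- The jet `f # η`. -/
def ofSmash : Smash K A V →ₗ[A] Jet K A V :=
  (AdicCompletion.of (KaehlerDifferential.ideal K A) (Smash K A V)).restrictScalars A

end Jet

/-- The virtual jets: the kernel of the anchor map. -/
def VirtualJet : Submodule A (Jet K A V) := LinearMap.ker (Jet.anchor K A V)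

namespace VirtualJet

variable {K A V}

instance : LieRing (VirtualJet K A V) where
  bracket x y := ⟨⁅x.1, y.1⁆, LinearMap.mem_ker.2 (by
    rw [Jet.anchor_lie, LinearMap.mem_ker.1 x.2, zero_lie])⟩
  add_lie x y z := Subtype.ext (add_lie _ _ _)
  lie_add x y z := Subtype.ext (lie_add _ _ _)
  lie_self x := Subtype.ext (lie_self _)
  leibniz_lie x y z := Subtype.ext (leibniz_lie _ _ _)

/-- The bracket of virtual jets is `A`-linear. -/
instance : LieAlgebra A (VirtualJet K A V) where
  lie_smul a x y := Subtype.ext (by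
    change ⁅x.1, a • y.1⁆ = a • ⁅x.1, y.1⁆
    rw [LieRinehartRing.leibniz_smul_right, Jet.lie_apply, LinearMap.mem_ker.1 x.2, zero_lie,
      zero_smul, add_zero])

end VirtualJet

section Strong

variable (L : Type w) [LieRing L] [LieAlgebra K L] [Module A L] [LieRingModule L A]

/-- The relations of the strong enveloping algebra of a Lie-Rinehart pair `(A, L)`, on the
generators `A ⊔ L`. -/
inductive StrongRel : FreeAlgebra K (A ⊕ L) → FreeAlgebra K (A ⊕ L) → Prop
  | scalar (r : K) : StrongRel (FreeAlgebra.ι K (Sum.inl (algebraMap K A r))) (algebraMap K _ r)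
  | add (a b : A) : StrongRel (FreeAlgebra.ι K (Sum.inl (a + b)))
      (FreeAlgebra.ι K (Sum.inl a) + FreeAlgebra.ι K (Sum.inl b))
  | mul (a b : A) : StrongRel (FreeAlgebra.ι K (Sum.inl (a * b)))
      (FreeAlgebra.ι K (Sum.inl a) * FreeAlgebra.ι K (Sum.inl b))
  | lie_add (x y : L) : StrongRel (FreeAlgebra.ι K (Sum.inr (x + y)))
      (FreeAlgebra.ι K (Sum.inr x) + FreeAlgebra.ι K (Sum.inr y))
  | lie_smul (r : K) (x : L) : StrongRel (FreeAlgebra.ι K (Sum.inr (r • x)))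
      (r • FreeAlgebra.ι K (Sum.inr x))
  | lie_lie (x y : L) : StrongRel (FreeAlgebra.ι K (Sum.inr ⁅x, y⁆))
      (FreeAlgebra.ι K (Sum.inr x) * FreeAlgebra.ι K (Sum.inr y)
        - FreeAlgebra.ι K (Sum.inr y) * FreeAlgebra.ι K (Sum.inr x))
  | leibniz (x : L) (a : A) :
      StrongRel (FreeAlgebra.ι K (Sum.inr x) * FreeAlgebra.ι K (Sum.inl a))
        (FreeAlgebra.ι K (Sum.inl ⁅x, a⁆)
          + FreeAlgebra.ι K (Sum.inl a) * FreeAlgebra.ι K (Sum.inr x))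
  | smul (a : A) (x : L) :
      StrongRel (FreeAlgebra.ι K (Sum.inl a) * FreeAlgebra.ι K (Sum.inr x))
        (FreeAlgebra.ι K (Sum.inr (a • x)))

/-- The strong enveloping algebra of a Lie-Rinehart pair `(A, L)`: the quotient of `A # U(L)` by
the ideal generated by the elements `f # η - 1 # f η`. -/
def StrongEnveloping : Type _ := RingQuot (StrongRel K A L)

namespace StrongEnveloping

instance : Ring (StrongEnveloping K A L) := inferInstanceAs (Ring (RingQuot (StrongRel K A L)))
instance : Algebra K (StrongEnveloping K A L) :=
  inferInstanceAs (Algebra K (RingQuot (StrongRel K A L)))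

variable {K A L} in
theorem rel {p q : FreeAlgebra K (A ⊕ L)} (h : StrongRel K A L p q) :
    (RingQuot.mkAlgHom K (StrongRel K A L) p : StrongEnveloping K A L) =
      RingQuot.mkAlgHom K (StrongRel K A L) q :=
  RingQuot.mkAlgHom_rel K h

/-- The canonical map from functions. -/
def ofFun : A →ₐ[K] StrongEnveloping K A L where
  toFun a := RingQuot.mkAlgHom K (StrongRel K A L) (FreeAlgebra.ι K (Sum.inl a))
  map_one' := by
    have := rel (K := K) (A := A) (L := L) (.scalar 1)
    rw [map_one, map_one, map_one] at this
    exact this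
  map_mul' a b := (rel (.mul a b)).trans (map_mul _ _ _)
  map_zero' := by
    have := rel (K := K) (A := A) (L := L) (.scalar 0)
    rw [map_zero, map_zero, map_zero] at this
    exact this
  map_add' a b := (rel (.add a b)).trans (map_add _ _ _)
  commutes' r := (rel (.scalar r)).trans (AlgHom.commutes _ _)

/-- The canonical map from the Lie algebra. -/
def ofLie : L →ₗ[K] StrongEnveloping K A L where
  toFun x := RingQuot.mkAlgHom K (StrongRel K A L) (FreeAlgebra.ι K (Sum.inr x))
  map_add' x y := (rel (.lie_add x y)).trans (map_add _ _ _)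
  map_smul' r x := (rel (.lie_smul r x)).trans (map_smul _ _ _)

theorem ofLie_lie (x y : L) : ofLie K A L ⁅x, y⁆ =
    ofLie K A L x * ofLie K A L y - ofLie K A L y * ofLie K A L x :=
  (rel (.lie_lie x y)).trans (by rw [map_sub, map_mul, map_mul]; rfl)

theorem ofLie_mul_ofFun (x : L) (a : A) : ofLie K A L x * ofFun K A L a =
    ofFun K A L ⁅x, a⁆ + ofFun K A L a * ofLie K A L x :=
  (map_mul _ _ _).symm.trans ((rel (.leibniz x a)).trans (by rw [map_add, map_mul]; rfl))

theorem ofFun_mul_ofLie (x : L) (a : A) :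
    ofFun K A L a * ofLie K A L x = ofLie K A L (a • x) :=
  (map_mul _ _ _).symm.trans (rel (.smul a x))

variable {K A L}

/-- The universal property of the strong enveloping algebra. -/
def lift {B : Type*} [Ring B] [Algebra K B] (f : A →ₐ[K] B) (g : L →ₗ[K] B)
    (h1 : ∀ x y, g ⁅x, y⁆ = g x * g y - g y * g x)
    (h2 : ∀ x a, g x * f a = f ⁅x, a⁆ + f a * g x)
    (h3 : ∀ a x, f a * g x = g (a • x)) : StrongEnveloping K A L →ₐ[K] B :=
  RingQuot.liftAlgHom K ⟨FreeAlgebra.lift K (Sum.elim f g), by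
    intro p q h
    induction h with
    | scalar r => simp only [FreeAlgebra.lift_ι_apply, Sum.elim_inl, AlgHom.commutes]
    | add a b => simp only [FreeAlgebra.lift_ι_apply, Sum.elim_inl, map_add]
    | mul a b => simp only [FreeAlgebra.lift_ι_apply, Sum.elim_inl, map_mul]
    | lie_add x y => simp only [FreeAlgebra.lift_ι_apply, Sum.elim_inr, map_add]
    | lie_smul r x => simp only [FreeAlgebra.lift_ι_apply, Sum.elim_inr, map_smul]
    | lie_lie x y => simp only [FreeAlgebra.lift_ι_apply, Sum.elim_inr, map_sub, map_mul, h1]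
    | leibniz x a =>
      simp only [FreeAlgebra.lift_ι_apply, Sum.elim_inr, Sum.elim_inl, map_add, map_mul, h2]
    | smul a x =>
      simp only [FreeAlgebra.lift_ι_apply, Sum.elim_inr, Sum.elim_inl, map_mul, h3]⟩

theorem lift_ofFun {B : Type*} [Ring B] [Algebra K B] (f : A →ₐ[K] B) (g : L →ₗ[K] B)
    (h1 h2 h3) (a : A) : lift f g h1 h2 h3 (ofFun K A L a) = f a :=
  (RingQuot.liftAlgHom_mkAlgHom_apply K _ _ _).trans
    (by simp only [FreeAlgebra.lift_ι_apply, Sum.elim_inl])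

theorem lift_ofLie {B : Type*} [Ring B] [Algebra K B] (f : A →ₐ[K] B) (g : L →ₗ[K] B)
    (h1 h2 h3) (x : L) : lift f g h1 h2 h3 (ofLie K A L x) = g x :=
  (RingQuot.liftAlgHom_mkAlgHom_apply K _ _ _).trans
    (by simp only [FreeAlgebra.lift_ι_apply, Sum.elim_inr])

end StrongEnveloping
end Strong
end Algebra

section Functoriality

variable {K : Type u} {A A' : Type v} [CommRing K] [CommRing A] [Algebra K A]
  [CommRing A'] [Algebra K A'] {σ : A →ₐ[K] A'}

section

variable {V V' : Type w} [LieRing V] [LieAlgebra K V] [Module A V] [LieRingModule V A]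
  [LieRinehartRing A V] [LieRinehartAlgebra K A V]
  [LieRing V'] [LieAlgebra K V'] [Module A' V'] [LieRingModule V' A']
  [LieRinehartRing A' V'] [LieRinehartAlgebra K A' V']

/-- A morphism of Lie-Rinehart pairs acts on `A # V` by `f # η ↦ σ f # τ η`. -/
def Smash.map (τ : LieRinehartAlgebra.Hom σ V V') : Smash K A V →ₗ[K] Smash K A' V' :=
  TensorProduct.map σ.toLinearMap τ.toLieHom.toLinearMap

theorem Smash.map_mk (τ : LieRinehartAlgebra.Hom σ V V') (f : A) (η : V) :
    Smash.map τ (mk K f η) = mk K (σ f) (τ η) := rfl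

theorem Smash.map_lie (τ : LieRinehartAlgebra.Hom σ V V') (x y : Smash K A V) :
    Smash.map τ ⁅x, y⁆ = ⁅Smash.map τ x, Smash.map τ y⁆ := by
  induction x using Smash.induction with
  | h0 => simp
  | h2 x x' h h' => simp only [add_lie, map_add, h, h']
  | h1 f η =>
  induction y using Smash.induction with
  | h0 => simp
  | h2 x x' h h' => simp only [lie_add, map_add, h, h']
  | h1 g μ =>
    simp only [mk_lie_mk, map_add, map_sub, map_mk, map_mul, τ.apply_lie, LieHom.map_lie]

theorem Smash.map_smul' (τ : LieRinehartAlgebra.Hom σ V V') (c : A ⊗[K] A) (x : Smash K A V) :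
    Smash.map τ (c • x) = Algebra.TensorProduct.map σ σ c • Smash.map τ x := by
  induction x using Smash.induction with
  | h0 => simp
  | h2 x y h h' => rw [smul_add, map_add, h, h', map_add, smul_add]
  | h1 f η =>
    induction c using TensorProduct.induction_on with
    | zero => simp
    | add x y h h' => rw [add_smul, map_add, h, h', map_add, add_smul]
    | tmul a b =>
      simp only [tmul_smul_mk, map_mk, map_mul, τ.map_smul_apply, Algebra.TensorProduct.map_tmul]

theorem Smash.map_anchor (τ : LieRinehartAlgebra.Hom σ V V') (x : Smash K A V) :
    Smash.anchor K A' V' (Smash.map τ x) = τ (Smash.anchor K A V x) := by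
  induction x using Smash.induction with
  | h0 => simp
  | h2 x y h h' => simp only [map_add, h, h']
  | h1 f η => simp only [map_mk, anchor_mk, τ.map_smul_apply]

theorem Smash.map_mem (τ : LieRinehartAlgebra.Hom σ V V') (m : ℕ) {x : Smash K A V}
    (hx : x ∈ filtration K A V m) : Smash.map τ x ∈ filtration K A' V' m := by
  have hle : (KaehlerDifferential.ideal K A).map (Algebra.TensorProduct.map σ σ) ≤
      KaehlerDifferential.ideal K A' := by
    rw [Ideal.map_le_iff_le_comap]
    intro c hc
    have h : ∀ c : A ⊗[K] A, Algebra.TensorProduct.lmul' K (Algebra.TensorProduct.map σ σ c) =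
        σ (Algebra.TensorProduct.lmul' K c) := by
      intro c
      induction c using TensorProduct.induction_on with
      | zero => simp
      | add x y h h' => simp only [map_add, h, h']
      | tmul a b => simp
    change Algebra.TensorProduct.lmul' K (Algebra.TensorProduct.map σ σ c) = 0
    rw [h, show Algebra.TensorProduct.lmul' K c = 0 from hc, map_zero]
  induction hx using Submodule.smul_induction_on' with
  | smul c hc y hy =>
    rw [map_smul']
    refine Submodule.smul_mem_smul (Ideal.pow_right_mono hle m ?_) trivial
    rw [← Ideal.map_pow]
    exact Ideal.mem_map_of_mem _ hc
  | add x hx y hy h h' => rw [map_add]; exact add_mem h h'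

/-- The map induced by `Smash.map` on the quotients. -/
def Smash.quotMap (τ : LieRinehartAlgebra.Hom σ V V') (m : ℕ)
    (x : Smash K A V ⧸ filtration K A V m) : Smash K A' V' ⧸ filtration K A' V' m :=
  Quotient.map (Smash.map τ) (by
    intro a a' h
    replace h := (Submodule.quotientRel_def _).1 h
    refine (Submodule.quotientRel_def _).2 ?_
    rw [← map_sub]
    exact map_mem τ m h) x

theorem Smash.quotMap_mk (τ : LieRinehartAlgebra.Hom σ V V') (m : ℕ) (x : Smash K A V) :
    quotMap τ m (Submodule.Quotient.mk x) = Submodule.Quotient.mk (Smash.map τ x) := rfl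

/-- The map induced by a morphism of Lie-Rinehart pairs on jets, level by level. -/
def Jet.mapFun (τ : LieRinehartAlgebra.Hom σ V V') (x : Jet K A V) : Jet K A' V' :=
  ⟨fun m => Smash.quotMap τ m (x.val m), by
    intro m m' h
    obtain ⟨a, ha⟩ := exists_rep x m'
    beta_reduce
    rw [ha, rep_of_le x h ha]
    rfl⟩

theorem Jet.mapFun_val (τ : LieRinehartAlgebra.Hom σ V V') (x : Jet K A V) (m : ℕ) :
    (Jet.mapFun τ x).val m = Smash.quotMap τ m (x.val m) := rfl

theorem Jet.anchor_mapFun (τ : LieRinehartAlgebra.Hom σ V V') (x : Jet K A V) :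
    anchor K A' V' (mapFun τ x) = τ (anchor K A V x) := by
  obtain ⟨a, ha⟩ := exists_rep x 1
  rw [anchor_eq x one_pos ha, ← Smash.map_anchor]
  exact anchor_eq _ one_pos (by rw [mapFun_val, ha, Smash.quotMap_mk])

theorem Jet.mapFun_smul (τ : LieRinehartAlgebra.Hom σ V V') (a : A) (x : Jet K A V) :
    mapFun τ (a • x) = σ a • mapFun τ x := by
  ext m
  obtain ⟨b, hb⟩ := exists_rep x m
  simp only [mapFun_val, AdicCompletion.val_smul_apply, hb, ← Submodule.Quotient.mk_smul,
    Smash.quotMap_mk]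
  rw [← Smash.includeLeft_smul (K := K), Smash.map_smul', Algebra.TensorProduct.map_tmul, map_one,
    Smash.includeLeft_smul]

/-- A morphism of Lie-Rinehart pairs `(A, V) → (A', V')` induces one on jets. -/
def Jet.map (τ : LieRinehartAlgebra.Hom σ V V') :
    LieRinehartAlgebra.Hom σ (Jet K A V) (Jet K A' V') where
  toFun := mapFun τ
  map_add' x y := by
    ext m
    obtain ⟨a, ha⟩ := exists_rep x m
    obtain ⟨b, hb⟩ := exists_rep y m
    simp only [mapFun_val, AdicCompletion.val_add_apply, ha, hb, Smash.quotMap_mk,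
      ← Submodule.Quotient.mk_add, map_add]
  map_smul' r x := by
    rw [RingHom.id_apply, ← algebraMap_smul A r x, mapFun_smul, AlgHom.commutes, algebraMap_smul]
  map_lie' {x y} := by
    ext m
    obtain ⟨a, ha⟩ := exists_rep x m
    obtain ⟨b, hb⟩ := exists_rep y m
    simp only [mapFun_val, lie_val, ha, hb, Smash.quotMap_mk, Smash.quotBracket_mk,
      Smash.map_lie]
  map_smul_apply' := mapFun_smul τ
  apply_lie' a x := by
    change σ ⁅anchor K A V x, a⁆ = ⁅anchor K A' V' (mapFun τ x), σ a⁆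
    rw [anchor_mapFun, τ.apply_lie]

theorem Jet.map_map {A'' : Type v} [CommRing A''] [Algebra K A''] {σ' : A' →ₐ[K] A''}
    {σ'' : A →ₐ[K] A''} {V'' : Type w} [LieRing V''] [LieAlgebra K V''] [Module A'' V'']
    [LieRingModule V'' A''] [LieRinehartRing A'' V''] [LieRinehartAlgebra K A'' V'']
    (τ : LieRinehartAlgebra.Hom σ V V') (τ' : LieRinehartAlgebra.Hom σ' V' V'')
    (τ'' : LieRinehartAlgebra.Hom σ'' V V'') (hσ : ∀ a, σ' (σ a) = σ'' a)
    (hτ : ∀ v, τ' (τ v) = τ'' v) (x : Jet K A V) : Jet.map τ' (Jet.map τ x) = Jet.map τ'' x := by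
  refine AdicCompletion.ext fun m => ?_
  obtain ⟨a, ha⟩ := exists_rep x m
  change Smash.quotMap τ' m (Smash.quotMap τ m (x.val m)) = Smash.quotMap τ'' m (x.val m)
  rw [ha, Smash.quotMap_mk, Smash.quotMap_mk, Smash.quotMap_mk]
  clear ha
  congr 1
  induction a using Smash.induction with
  | h0 => simp only [map_zero]
  | h2 x y h h' => simp only [map_add, h, h']
  | h1 f η => rw [Smash.map_mk, Smash.map_mk, Smash.map_mk, hσ, hτ]

end

variable {L L' : Type w} [LieRing L] [LieAlgebra K L] [Module A L] [LieRingModule L A]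
  [LieRing L'] [LieAlgebra K L'] [Module A' L'] [LieRingModule L' A']

/-- A morphism of Lie-Rinehart pairs induces a morphism of strong enveloping algebras. -/
def StrongEnveloping.map (τ : LieRinehartAlgebra.Hom σ L L') :
    StrongEnveloping K A L →ₐ[K] StrongEnveloping K A' L' :=
  lift ((ofFun K A' L').comp σ) ((ofLie K A' L').comp τ.toLieHom.toLinearMap)
    (fun x y => (congrArg (ofLie K A' L') (LieHom.map_lie τ.toLieHom x y)).trans (ofLie_lie K A' L' _ _))
    (fun x a => (ofLie_mul_ofFun K A' L' _ _).trans
      (congrArg (fun b => ofFun K A' L' b + _) (τ.apply_lie a x).symm))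
    (fun a x => (ofFun_mul_ofLie K A' L' _ _).trans
      (congrArg (ofLie K A' L') (τ.map_smul_apply a x).symm))

theorem StrongEnveloping.map_ofFun (τ : LieRinehartAlgebra.Hom σ L L') (a : A) :
    StrongEnveloping.map τ (ofFun K A L a) = ofFun K A' L' (σ a) :=
  lift_ofFun _ _ _ _ _ _

theorem StrongEnveloping.map_ofLie (τ : LieRinehartAlgebra.Hom σ L L') (x : L) :
    StrongEnveloping.map τ (ofLie K A L x) = ofLie K A' L' (τ x) :=
  lift_ofLie _ _ _ _ _ _

end Functoriality

section Series

open scoped Nat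

variable {K : Type u} {A : Type v} {V : Type w} [Field K] [CommRing A] [Algebra K A]
  [LieRing V] [LieAlgebra K V] [Module A V] [LieRingModule V A]
  [LieRinehartRing A V] [LieRinehartAlgebra K A V] {n : ℕ}

/-- `δ(x)^s = ∏ i, (1 ⊗ x_i - x_i ⊗ 1) ^ s_i`. -/
def deltaPow (K : Type u) {A : Type v} [Field K] [CommRing A] [Algebra K A] (x : Fin n → A)
    (s : Fin n →₀ ℕ) : A ⊗[K] A :=
  ∏ i, ((1 : A) ⊗ₜ[K] x i - x i ⊗ₜ[K] (1 : A)) ^ s i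

theorem deltaPow_mem (x : Fin n → A) (s : Fin n →₀ ℕ) :
    deltaPow K x s ∈ KaehlerDifferential.ideal K A ^ (∑ i, s i) := by
  rw [deltaPow, ← Finset.prod_pow_eq_pow_sum]
  refine Ideal.prod_mem_prod fun i _ => Ideal.pow_mem_pow ?_ _
  rw [RingHom.mem_ker]
  simp

/-- The jet `∑ s, F_s δ(x)^s (1 # η)` attached to a power series `F = ∑ s, F_s X^s` with
coefficients in `A`. -/
def Jet.ofSeries (x : Fin n → A) (F : MvPowerSeries (Fin n) A) (η : V) : Jet K A V :=
  AdicCompletion.mk _ _ (AdicCompletion.AdicCauchySequence.mk _ _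
    (fun m => ∑ d ∈ Finset.range m, ∑ s ∈ Finset.univ.finsuppAntidiag d,
      MvPowerSeries.coeff s F • deltaPow K x s • Smash.mk K 1 η) (by
    intro m
    rw [Finset.sum_range_succ, SModEq.comm, SModEq.sub_mem, add_sub_cancel_left]
    refine sum_mem fun s hs => ?_
    rw [← Smash.includeLeft_smul (K := K)]
    refine Submodule.smul_mem _ _ (Submodule.smul_mem_smul ?_ trivial)
    have := deltaPow_mem (K := K) x s
    rwa [(Finset.mem_finsuppAntidiag.1 hs).1] at this))

theorem Jet.anchor_ofSeries (x : Fin n → A) (F : MvPowerSeries (Fin n) A) (η : V) :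
    Jet.anchor K A V (Jet.ofSeries x F η) = MvPowerSeries.constantCoeff F • η := by
  rw [Jet.anchor_eq (Jet.ofSeries x F η) one_pos (a := MvPowerSeries.coeff 0 F • Smash.mk K 1 η)]
  · simp [Smash.anchor_mk]
  · simp [Jet.ofSeries, deltaPow]

/-- The Taylor series `f(x + X) = ∑ s, (1 / s!) (∂^s f) X^s` for the vector fields `del i`. -/
def taylor (K : Type u) {A : Type v} {V : Type w} [Field K] [CommRing A] [Algebra K A]
    [LieRing V] [LieAlgebra K V] [Module A V] [LieRingModule V A]
    [LieRinehartRing A V] [LieRinehartAlgebra K A V] (del : Fin n → V) (f : A) :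
    MvPowerSeries (Fin n) A :=
  fun s => ((∏ i, (s i)! : ℕ) : K)⁻¹ •
    (List.ofFn fun i => (LieModule.toEnd K V A (del i)) ^ s i).prod f

theorem constantCoeff_taylor (del : Fin n → V) (f : A) :
    MvPowerSeries.constantCoeff (taylor K del f) = f := by
  rw [← MvPowerSeries.coeff_zero_eq_constantCoeff_apply]
  change ((∏ i, ((0 : Fin n →₀ ℕ) i)! : ℕ) : K)⁻¹ •
    (List.ofFn fun i => (LieModule.toEnd K V A (del i)) ^ (0 : Fin n →₀ ℕ) i).prod f = f
  simp

end Series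
section Geometry

variable (K : Type u) [Field K] {X : Scheme.{u}} [X.Over (Spec (CommRingCat.of K))]

instance sectionAlgebra (U : X.Opens) : Algebra K Γ(X, U) :=
  (((X ↘ Spec (CommRingCat.of K)).appLE ⊤ U le_top).hom.comp
    (Scheme.ΓSpecIso (CommRingCat.of K)).inv.hom).toAlgebra

/-- Restriction of functions. -/
def resFun {U W : X.Opens} (h : W ≤ U) : Γ(X, U) →ₐ[K] Γ(X, W) where
  __ := (X.presheaf.map (homOfLE h).op).hom
  commutes' r := by
    have := Scheme.Hom.appLE_map (X ↘ Spec (CommRingCat.of K)) (U := ⊤) (V := U) le_top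
      (homOfLE h).op
    exact congrArg (fun φ => φ.hom ((Scheme.ΓSpecIso (CommRingCat.of K)).inv.hom r)) this

theorem resFun_resFun {U W W' : X.Opens} (h : W ≤ U) (h' : W' ≤ W) (f : Γ(X, U)) :
    resFun K h' (resFun K h f) = resFun K (h'.trans h) f := by
  change (X.presheaf.map (homOfLE h).op ≫ X.presheaf.map (homOfLE h').op).hom f = _
  rw [← X.presheaf.map_comp]
  rfl

theorem resFun_self {U : X.Opens} (f : Γ(X, U)) : resFun K le_rfl f = f := by
  change (X.presheaf.map (𝟙 _)).hom f = f
  rw [X.presheaf.map_id]; rfl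

/-- Vector fields on `U`: derivations of the sheaf of functions on `U`, that is, families of
derivations of `Γ(X, W)`, for `W ≤ U` open, compatible with restrictions. -/
def vectorFields (U : X.Opens) :
    Submodule K (∀ W : {W : X.Opens // W ≤ U}, Derivation K Γ(X, W.1) Γ(X, W.1)) where
  carrier := {D | ∀ (W W' : {W : X.Opens // W ≤ U}) (h : W'.1 ≤ W.1) (f : Γ(X, W.1)),
      resFun K h (D W f) = D W' (resFun K h f)}
  zero_mem' _ _ _ _ := by simp
  add_mem' hD hE W W' h f := by simp [hD W W' h, hE W W' h]
  smul_mem' r D hD W W' h f := by simp [hD W W' h]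

/-- The type of vector fields on `U`. -/
abbrev VectorField (U : X.Opens) : Type u := vectorFields K U

namespace VectorField

variable {K} {U : X.Opens}

theorem ext' {D E : VectorField K U} (h : ∀ W f, D.1 W f = E.1 W f) : D = E :=
  Subtype.ext (funext fun W => Derivation.ext (h W))

/-- The commutator. -/
instance : LieRing (VectorField K U) where
  bracket D E := ⟨fun W => ⁅D.1 W, E.1 W⁆, fun W W' h f => by
    simp only [Derivation.commutator_apply, map_sub, D.2 W W' h, E.2 W W' h]⟩
  add_lie D E F := ext' fun W f => by
    change ⁅D.1 W + E.1 W, F.1 W⁆ f = (⁅D.1 W, F.1 W⁆ + ⁅E.1 W, F.1 W⁆) f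
    rw [add_lie]
  lie_add D E F := ext' fun W f => by
    change ⁅D.1 W, E.1 W + F.1 W⁆ f = (⁅D.1 W, E.1 W⁆ + ⁅D.1 W, F.1 W⁆) f
    rw [lie_add]
  lie_self D := ext' fun W f => by
    change ⁅D.1 W, D.1 W⁆ f = 0
    rw [lie_self]; rfl
  leibniz_lie D E F := ext' fun W f => by
    change ⁅D.1 W, ⁅E.1 W, F.1 W⁆⁆ f = (⁅⁅D.1 W, E.1 W⁆, F.1 W⁆ + ⁅E.1 W, ⁅D.1 W, F.1 W⁆⁆) f
    rw [leibniz_lie]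

instance : LieAlgebra K (VectorField K U) where
  lie_smul r D E := ext' fun W f => by
    change D.1 W (r • E.1 W f) - r • E.1 W (D.1 W f) = r • (D.1 W (E.1 W f) - E.1 W (D.1 W f))
    rw [Derivation.map_smul, smul_sub]

/-- Multiplication of vector fields by functions. -/
instance : Module Γ(X, U) (VectorField K U) where
  smul a D := ⟨fun W => resFun K W.2 a • D.1 W, fun W W' h f => by
    simp only [Derivation.smul_apply, smul_eq_mul, map_mul, D.2 W W' h, resFun_resFun]⟩
  one_smul D := ext' fun W f => by
    change resFun K W.2 1 * D.1 W f = D.1 W f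
    rw [map_one, one_mul]
  mul_smul a b D := ext' fun W f => by
    change resFun K W.2 (a * b) * D.1 W f = resFun K W.2 a * (resFun K W.2 b * D.1 W f)
    rw [map_mul, mul_assoc]
  smul_zero a := ext' fun W f => by
    change resFun K W.2 a * 0 = 0
    rw [mul_zero]
  smul_add a D E := ext' fun W f => by
    change resFun K W.2 a * (D.1 W f + E.1 W f) = resFun K W.2 a * D.1 W f + resFun K W.2 a * E.1 W f
    rw [mul_add]
  add_smul a b D := ext' fun W f => by
    change resFun K W.2 (a + b) * D.1 W f = resFun K W.2 a * D.1 W f + resFun K W.2 b * D.1 W f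
    rw [map_add, add_mul]
  zero_smul D := ext' fun W f => by
    change resFun K W.2 0 * D.1 W f = 0
    rw [map_zero, zero_mul]

/-- A vector field on `U` as a derivation of `Γ(X, U)`. -/
def toDerivation (D : VectorField K U) : Derivation K Γ(X, U) Γ(X, U) := D.1 ⟨U, le_rfl⟩

instance : LieRingModule (VectorField K U) Γ(X, U) where
  bracket D f := D.toDerivation f
  add_lie _ _ _ := rfl
  lie_add D := map_add D.toDerivation
  leibniz_lie D E f := by
    change D.toDerivation (E.toDerivation f) =
      ⁅D.toDerivation, E.toDerivation⁆ f + E.toDerivation (D.toDerivation f)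
    rw [Derivation.commutator_apply]; abel

theorem lie_apply (D : VectorField K U) (f : Γ(X, U)) : ⁅D, f⁆ = D.toDerivation f := rfl

instance : LieRinehartRing Γ(X, U) (VectorField K U) where
  lie_smul_eq_mul' a f D := by
    change resFun K le_rfl a * _ = _
    rw [resFun_self]; rfl
  leibniz_mul_right' D f g := by
    simp only [lie_apply, Derivation.leibniz, smul_eq_mul]; ring
  leibniz_smul_right' D E a := ext' fun W f => by
    change D.1 W (resFun K W.2 a * E.1 W f) - resFun K W.2 a * E.1 W (D.1 W f) =
      resFun K W.2 a * (D.1 W (E.1 W f) - E.1 W (D.1 W f)) +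
        resFun K W.2 (D.1 ⟨U, le_rfl⟩ a) * E.1 W f
    rw [D.2 ⟨U, le_rfl⟩ W W.2, Derivation.leibniz, smul_eq_mul, smul_eq_mul]; ring

instance : LieRinehartAlgebra K Γ(X, U) (VectorField K U) where
  smul_assoc r a D := ext' fun W f => by
    change resFun K W.2 (r • a) * D.1 W f = r • (resFun K W.2 a * D.1 W f)
    rw [map_smul, smul_mul_assoc]
  smul_lie _ _ _ := rfl
  lie_smul r D f := D.toDerivation.map_smul r f

/-- Restriction of vector fields. -/
def res {W : X.Opens} (h : W ≤ U) :
    LieRinehartAlgebra.Hom (resFun K h) (VectorField K U) (VectorField K W) where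
  toFun D := ⟨fun W' => D.1 ⟨W'.1, le_trans W'.2 h⟩, fun W₁ W₂ h' f =>
    D.2 ⟨W₁.1, le_trans W₁.2 h⟩ ⟨W₂.1, le_trans W₂.2 h⟩ h' f⟩
  map_add' _ _ := rfl
  map_smul' _ _ := rfl
  map_lie' := rfl
  map_smul_apply' a D := ext' fun W' f => by
    change resFun K _ a * _ = resFun K _ (resFun K _ a) * _
    rw [resFun_resFun]
    rfl
  apply_lie' f D := D.2 ⟨U, le_rfl⟩ ⟨W, h⟩ h f

end VectorField

/-- Jets of vector fields on `U`. -/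
abbrev JetField (U : X.Opens) : Type u := Jet K Γ(X, U) (VectorField K U)

/-- Virtual jets of vector fields on `U`: those killed by the anchor map. -/
abbrev VirtualJetField (U : X.Opens) : Submodule Γ(X, U) (JetField K U) :=
  VirtualJet K Γ(X, U) (VectorField K U)

/-- Restriction of jets. -/
def JetField.res {U W : X.Opens} (h : W ≤ U) :
    LieRinehartAlgebra.Hom (resFun K h) (JetField K U) (JetField K W) :=
  Jet.map (VectorField.res h)

theorem JetField.res_res {U W W' : X.Opens} (h : W ≤ U) (h' : W' ≤ W) (x : JetField K U) :
    JetField.res K h' (JetField.res K h x) = JetField.res K (h'.trans h) x :=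
  Jet.map_map _ _ _ (fun _ => resFun_resFun K _ _ _) (fun _ => rfl) x

/-- Restriction of virtual jets. -/
def VirtualJetField.res {U W : X.Opens} (h : W ≤ U) (l : VirtualJetField K U) :
    VirtualJetField K W :=
  ⟨JetField.res K h l.1, LinearMap.mem_ker.2 (by
    refine (Jet.anchor_mapFun _ _).trans ?_
    rw [LinearMap.mem_ker.1 l.2]
    exact map_zero (VectorField.res h).toLieHom)⟩

/-- An étale chart: an affine open set with uniformizing parameters `x`. The vector fields `del i`
are the (unique) extensions of `∂/∂x_i`. -/
structure EtaleChart (n : ℕ) (U : X.Opens) where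
  isAffineOpen : IsAffineOpen U
  x : Fin n → Γ(X, U)
  algebraicIndependent : AlgebraicIndependent K x
  isAlgebraic : ∀ f : Γ(X, U), IsAlgebraic (Algebra.adjoin K (Set.range x)) f
  del : Fin n → VectorField K U
  del_x : ∀ i j, (del i).toDerivation (x j) = if i = j then 1 else 0

namespace EtaleChart

variable {K} {n : ℕ} {U : X.Opens} (c : EtaleChart K n U)

/-- The element `F(x, X) ∂/∂X_j` of the virtual jets, where `F` is a power series in `X` with
coefficients in `Γ(X, U)` and without constant term; `X_i` stands for `1 ⊗ x_i - x_i ⊗ 1`. -/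
def virtualJet (F : MvPowerSeries (Fin n) Γ(X, U)) (hF : MvPowerSeries.constantCoeff F = 0)
    (j : Fin n) : VirtualJetField K U :=
  ⟨Jet.ofSeries c.x F (c.del j), LinearMap.mem_ker.2 (by
    rw [Jet.anchor_ofSeries, hF, zero_smul])⟩

/-- The series `f(x + X) - f(x)`. -/
def taylorTail (f : Γ(X, U)) : MvPowerSeries (Fin n) Γ(X, U) :=
  taylor K c.del f - MvPowerSeries.C f

theorem constantCoeff_taylorTail (f : Γ(X, U)) :
    MvPowerSeries.constantCoeff (c.taylorTail f) = 0 := by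
  rw [taylorTail, map_sub, constantCoeff_taylor, MvPowerSeries.constantCoeff_C, sub_self]

/-- `∂/∂x_i` applied to the coefficients of a power series. -/
def coeffDeriv (i : Fin n) (F : MvPowerSeries (Fin n) Γ(X, U)) : MvPowerSeries (Fin n) Γ(X, U) :=
  fun s => (c.del i).toDerivation (MvPowerSeries.coeff s F)

theorem constantCoeff_coeffDeriv (i : Fin n) {F : MvPowerSeries (Fin n) Γ(X, U)}
    (hF : MvPowerSeries.constantCoeff F = 0) :
    MvPowerSeries.constantCoeff (c.coeffDeriv i F) = 0 := by
  rw [← MvPowerSeries.coeff_zero_eq_constantCoeff_apply] at hF ⊢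
  change (c.del i).toDerivation (MvPowerSeries.coeff 0 F) = 0
  rw [hF, map_zero]

end EtaleChart

/-- Differential operators on a commutative algebra `A`: the subalgebra of `End_K(A)` generated by
`A` and the derivations of `A`. -/
def DiffOp (A : Type u) [CommRing A] [Algebra K A] : Subalgebra K (Module.End K A) :=
  Algebra.adjoin K (Set.range (Algebra.lmul K A) ∪
    Set.range (fun D : Derivation K A A => (D : Module.End K A)))

/-- Multiplication by a function, as a differential operator. -/
def DiffOp.ofFun {A : Type u} [CommRing A] [Algebra K A] (a : A) : DiffOp K A :=
  ⟨Algebra.lmul K A a, Algebra.subset_adjoin (Or.inl ⟨a, rfl⟩)⟩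

/-- A derivation, as a differential operator. -/
def DiffOp.ofDerivation {A : Type u} [CommRing A] [Algebra K A] (D : Derivation K A A) :
    DiffOp K A :=
  ⟨D, Algebra.subset_adjoin (Or.inr ⟨D, rfl⟩)⟩

/-- Restriction of sections of a sheaf of modules. -/
def resMod {M : X.Modules} {U W : X.Opens} (h : W ≤ U) (m : Γ(M, U)) : Γ(M, W) :=
  M.presheaf.map (homOfLE h).op m

/-- A module over the sheaf of virtual jets: a sheaf of `O`-modules `M` with an `O`-linear morphism
of sheaves of Lie algebras from virtual jets to endomorphisms of `M`, given on affine open sets. -/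
structure VirtualJetModule (M : X.Modules) where
  jetAct : ∀ {U : X.Opens}, IsAffineOpen U →
    (VirtualJetField K U →ₗ[Γ(X, U)] Module.End Γ(X, U) Γ(M, U))
  jetAct_lie : ∀ {U : X.Opens} (hU : IsAffineOpen U) (l l' : VirtualJetField K U) (m : Γ(M, U)),
    jetAct hU ⁅l, l'⁆ m = jetAct hU l (jetAct hU l' m) - jetAct hU l' (jetAct hU l m)
  jetAct_res : ∀ {U W : X.Opens} (hU : IsAffineOpen U) (hW : IsAffineOpen W) (h : W ≤ U)
    (l : VirtualJetField K U) (m : Γ(M, U)),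
    resMod h (jetAct hU l m) = jetAct hW (VirtualJetField.res K h l) (resMod h m)

/-- A module over virtual jets which is a charged `D`-module: in each étale chart `(U, x)` the
differential operators on `U` act on `Γ(M, U)`, with the usual action of functions, such that
* `[∂/∂x_i, F(x, X) ∂/∂X_j] = (∂F/∂x_i)(x, X) ∂/∂X_j`;
* if `(U, x)` and `(W, y)` are étale charts with `W ≤ U` then, on `W`, with
  `h_j = ∂y_j/∂x_i`, the operator `∂/∂x_i` is
  `∑ j, h_j ∂/∂y_j + (h_j(y + Y) - h_j(y)) ∂/∂Y_j`. -/
structure ChargedDModule (n : ℕ) (M : X.Modules) extends VirtualJetModule K M where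
  diffAct : ∀ {U : X.Opens}, EtaleChart K n U → (DiffOp K Γ(X, U) →+* AddMonoid.End Γ(M, U))
  diffAct_fun : ∀ {U : X.Opens} (c : EtaleChart K n U) (a : Γ(X, U)) (m : Γ(M, U)),
    diffAct c (DiffOp.ofFun K a) m = a • m
  diffAct_comm : ∀ {U : X.Opens} (c : EtaleChart K n U) (i j : Fin n)
    (F : MvPowerSeries (Fin n) Γ(X, U)) (hF : MvPowerSeries.constantCoeff F = 0) (m : Γ(M, U)),
    diffAct c (DiffOp.ofDerivation K (c.del i).toDerivation)
        (jetAct c.isAffineOpen (c.virtualJet F hF j) m)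
      - jetAct c.isAffineOpen (c.virtualJet F hF j)
        (diffAct c (DiffOp.ofDerivation K (c.del i).toDerivation) m)
      = jetAct c.isAffineOpen
        (c.virtualJet (c.coeffDeriv i F) (c.constantCoeff_coeffDeriv i hF) j) m
  diffAct_trans : ∀ {U W : X.Opens} (h : W ≤ U) (c : EtaleChart K n U) (d : EtaleChart K n W)
    (i : Fin n) (m : Γ(M, U)),
    resMod h (diffAct c (DiffOp.ofDerivation K (c.del i).toDerivation) m) =
      ∑ j, (((VectorField.res h (c.del i)).toDerivation (d.x j)) •
          diffAct d (DiffOp.ofDerivation K (d.del j).toDerivation) (resMod h m)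
        + jetAct d.isAffineOpen
          (d.virtualJet (d.taylorTail ((VectorField.res h (c.del i)).toDerivation (d.x j)))
            (d.constantCoeff_taylorTail _) j) (resMod h m))

/-- The completion of `A # U(V)`, `A = Γ(X, U)`, for an étale chart `U`: the strong enveloping
algebra of functions and jets of vector fields. -/
def AVLocal (U : X.Opens) : Type u := StrongEnveloping K Γ(X, U) (JetField K U)

instance (U : X.Opens) : Ring (AVLocal K U) :=
  inferInstanceAs (Ring (StrongEnveloping K Γ(X, U) (JetField K U)))
instance (U : X.Opens) : Algebra K (AVLocal K U) :=
  inferInstanceAs (Algebra K (StrongEnveloping K Γ(X, U) (JetField K U)))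

/-- Functions in the completion of `A # U(V)`. -/
def AVLocal.ofFun (U : X.Opens) : Γ(X, U) →ₐ[K] AVLocal K U := StrongEnveloping.ofFun K _ _

/-- Jets of vector fields in the completion of `A # U(V)`. -/
def AVLocal.ofJet (U : X.Opens) : JetField K U →ₗ[K] AVLocal K U := StrongEnveloping.ofLie K _ _

/-- Restriction. -/
def AVLocal.res {U W : X.Opens} (h : W ≤ U) : AVLocal K U →ₐ[K] AVLocal K W :=
  StrongEnveloping.map (JetField.res K h)

theorem AVLocal.res_ofFun {U W : X.Opens} (h : W ≤ U) (f : Γ(X, U)) :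
    AVLocal.res K h (AVLocal.ofFun K U f) = AVLocal.ofFun K W (resFun K h f) :=
  StrongEnveloping.map_ofFun _ _

theorem AVLocal.res_ofJet {U W : X.Opens} (h : W ≤ U) (x : JetField K U) :
    AVLocal.res K h (AVLocal.ofJet K U x) = AVLocal.ofJet K W (JetField.res K h x) :=
  StrongEnveloping.map_ofLie _ _

/-- Sections over an open set `W` of the sheaf `AV` glued from the algebras `AVLocal K U`, `U` an
étale chart: compatible families indexed by the étale charts contained in `W`. -/
def AV (n : ℕ) (W : X.Opens) :
    Subalgebra K (∀ U : {U : X.Opens // Nonempty (EtaleChart K n U) ∧ U ≤ W}, AVLocal K U.1) where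
  carrier := {s | ∀ (U U' : {U : X.Opens // Nonempty (EtaleChart K n U) ∧ U ≤ W})
    (h : U'.1 ≤ U.1), AVLocal.res K h (s U) = s U'}
  mul_mem' hs ht U U' h := (map_mul _ _ _).trans (congrArg₂ (· * ·) (hs U U' h) (ht U U' h))
  add_mem' hs ht U U' h := (map_add _ _ _).trans (congrArg₂ (· + ·) (hs U U' h) (ht U U' h))
  algebraMap_mem' r _ _ h := (AVLocal.res K h).commutes r

namespace AV

variable (n : ℕ)

/-- Restriction of sections of `AV`. -/
def res {W W' : X.Opens} (h : W' ≤ W) (s : AV K n W) : AV K n W' :=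
  ⟨fun U => s.1 ⟨U.1, U.2.1, U.2.2.trans h⟩, fun U U' h' =>
    s.2 ⟨U.1, U.2.1, U.2.2.trans h⟩ ⟨U'.1, U'.2.1, U'.2.2.trans h⟩ h'⟩

/-- Sections of `AV` given by functions. -/
def ofFun {W : X.Opens} (f : Γ(X, W)) : AV K n W :=
  ⟨fun U => AVLocal.ofFun K U.1 (resFun K U.2.2 f), fun U U' h => by
    rw [AVLocal.res_ofFun, resFun_resFun]⟩

/-- Sections of `AV` given by jets of vector fields. -/
def ofJet {W : X.Opens} (x : JetField K W) : AV K n W :=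
  ⟨fun U => AVLocal.ofJet K U.1 (JetField.res K U.2.2 x), fun U U' h => by
    rw [AVLocal.res_ofJet, JetField.res_res]⟩

/-- Sections of `AV` given by vector fields `η`, that is, by the jets `1 # η`. -/
def ofVectorField {W : X.Opens} (η : VectorField K W) : AV K n W :=
  ofJet K n (Jet.ofSmash K _ _ (Smash.mk K 1 η))

end AV

/-- A structure of a sheaf of modules over the sheaf of algebras `AV` on a sheaf of `O`-modules,
extending the action of functions. -/
structure AVModule (n : ℕ) (M : X.Modules) where
  act : ∀ W : X.Opens, AV K n W →+* AddMonoid.End Γ(M, W)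
  act_fun : ∀ (W : X.Opens) (f : Γ(X, W)) (m : Γ(M, W)), act W (AV.ofFun K n f) m = f • m
  act_res : ∀ {W W' : X.Opens} (h : W' ≤ W) (s : AV K n W) (m : Γ(M, W)),
    resMod h (act W s m) = act W' (AV.res K n h s) (resMod h m)

attribute [local instance] MvPolynomial.gradedAlgebra

/-- `X` is quasi-projective over `K`: it admits an immersion (over `K`) in a projective space. -/
def IsQuasiProjective (X : Scheme.{u}) [X.Over (Spec (CommRingCat.of K))] : Prop :=
  ∃ (N : ℕ) (i : X ⟶ Proj (MvPolynomial.homogeneousSubmodule (Fin (N + 1)) K)), IsImmersion i ∧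
    i ≫ Proj.toSpecZero (MvPolynomial.homogeneousSubmodule (Fin (N + 1)) K) ≫
      Spec.map (CommRingCat.ofHom (algebraMap K
        (MvPolynomial.homogeneousSubmodule (Fin (N + 1)) K 0))) = X ↘ Spec (CommRingCat.of K)

end Geometry
end AVSheaf

end

open AVSheaf

/-! In a chart with coordinates x, a jet y differs from the combination ∑ y(x_i) (1 # ∂/∂x_i) by a
virtual jet, so the only possible action of y is ∑ y(x_i) ∂/∂x_i plus the given action of that
virtual jet (`IsFrame.jetOp`). This respects brackets (`IsFrame.jetOp_lie`) because it does so on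
generators: virtual jets act as a Lie algebra, the ∂/∂x_i commute, and the bracket of 1 # ∂/∂x_i
with F ∂/∂X_j differentiates the coefficients of F, which is condition (1). The universal property
of the strong enveloping algebra then gives the action in the chart.

Condition (1) speaks only of the jets F ∂/∂X_j, so every virtual jet has to be written as a finite
sum of these. This rests on Taylor's formula along the diagonal (`IsFrame.sub_taylorPoly_mem`), with
δ(x_i) = 1 ⊗ x_i - x_i ⊗ 1 as variables. Its proof uses the Euler operator ∑ δ(x_i) (1 ⊗ ∂_i), which
acts on Δ^m / Δ^(m+1) as multiplication by m (`IsFrame.euler_mem`). In characteristic 0 an element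
of Δ whose derivatives lie in Δ^m is therefore in Δ^(m+1). The same formula identifies 1 # f ∂_i
with the series f(x + X) ∂/∂X_i, and separating its constant term yields the formula for ρ.

Condition (2) says that the restriction of ∂/∂x_i, expanded as ∑ h_j ∂/∂y_j, acts in the chart y by
ρ. Hence the chart actions commute with restriction (`ChargedDModule.chartAct_res`), even between
two coordinate systems on one open set. Étale charts form a basis of the topology
(`exists_etaleChart`), so the actions glue.

The geometric input is `EtaleChart.isFrame`: by algebraicity a derivation killing the coordinates is
zero, and since the differentials form a projective module, the δ(x_i) span Δ / Δ^2. -/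

noncomputable section

namespace AVSheaf

/-! ### Taylor's formula along the diagonal. -/

section Frame

open scoped Nat

variable {K : Type u} {A : Type v} {V : Type w} [Field K] [CommRing A] [Algebra K A]
  [LieRing V] [LieAlgebra K V] [Module A V] [LieRingModule V A]
  [LieRinehartRing A V] [LieRinehartAlgebra K A V] {n : ℕ}

/-- The element `1 ⊗ a - a ⊗ 1` of `A ⊗ A`. -/
def delta (K : Type u) {A : Type v} [Field K] [CommRing A] [Algebra K A] (a : A) : A ⊗[K] A :=
  (1 : A) ⊗ₜ[K] a - a ⊗ₜ[K] (1 : A)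

theorem delta_mem (a : A) : delta K a ∈ KaehlerDifferential.ideal K A := by
  rw [RingHom.mem_ker]
  simp [delta]

theorem lmul_smul (a : A) (c : A ⊗[K] A) :
    Algebra.TensorProduct.lmul' K (a • c) = a * Algebra.TensorProduct.lmul' K c := by
  rw [Algebra.smul_def, map_mul]
  simp [Algebra.TensorProduct.algebraMap_apply]

/-- The derivation `1 ⊗ η` of `A ⊗ A`. -/
def rightDer (K : Type u) {A : Type v} {V : Type w} [Field K] [CommRing A] [Algebra K A]
    [LieRing V] [LieAlgebra K V] [Module A V] [LieRingModule V A]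
    [LieRinehartRing A V] [LieRinehartAlgebra K A V] (η : V) : A ⊗[K] A →ₗ[A] A ⊗[K] A :=
  (LieModule.toEnd K V A η).baseChange A

theorem rightDer_tmul (η : V) (a b : A) : rightDer K η (a ⊗ₜ b) = a ⊗ₜ[K] ⁅η, b⁆ := rfl

theorem rightDer_mul (η : V) (c d : A ⊗[K] A) :
    rightDer K η (c * d) = c * rightDer K η d + rightDer K η c * d := by
  induction c using TensorProduct.induction_on with
  | zero => simp
  | add x y h h' => simp only [add_mul, map_add, h, h']; ring
  | tmul a b =>
  induction d using TensorProduct.induction_on with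
  | zero => simp
  | add x y h h' => simp only [mul_add, map_add, h, h']; ring
  | tmul a' b' =>
    simp only [Algebra.TensorProduct.tmul_mul_tmul, rightDer_tmul,
      LieRinehartRing.leibniz_mul_right, smul_eq_mul, TensorProduct.tmul_add]

theorem lie_one' (η : V) : ⁅η, (1 : A)⁆ = 0 := by
  have := LieRinehartRing.leibniz_mul_right (A₁ := A) η 1 1
  simpa using this

theorem rightDer_one (η : V) : rightDer K η (1 : A ⊗[K] A) = 0 := by
  rw [Algebra.TensorProduct.one_def, rightDer_tmul, lie_one', TensorProduct.tmul_zero]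

theorem rightDer_delta (η : V) (a : A) : rightDer K η (delta K a) = 1 ⊗ₜ ⁅η, a⁆ := by
  rw [delta, map_sub, rightDer_tmul, rightDer_tmul, lie_one', TensorProduct.tmul_zero, sub_zero]

/-- By the Leibniz rule a derivation removes at most one factor from a product of elements of Δ. -/
theorem rightDer_mem (η : V) (m : ℕ) {c : A ⊗[K] A}
    (hc : c ∈ KaehlerDifferential.ideal K A ^ (m + 1)) :
    rightDer K η c ∈ KaehlerDifferential.ideal K A ^ m := by
  induction m generalizing c with
  | zero => simp
  | succ m ih =>
    rw [pow_succ] at hc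
    induction hc using Submodule.mul_induction_on' with
    | mem_mul_mem a ha b hb =>
      rw [rightDer_mul]
      refine add_mem (Ideal.mul_mem_right _ _ ha) ?_
      rw [pow_succ]
      exact Ideal.mul_mem_mul (ih ha) hb
    | add x hx y hy ih₁ ih₂ => rw [map_add]; exact add_mem ih₁ ih₂

/-- Functions `x` and vector fields `del` which behave like local coordinates and their partial
derivatives: `del` is the basis dual to the differentials of `x`, and these differentials span. -/
structure IsFrame (K : Type u) {A : Type v} {V : Type w} [Field K] [CommRing A] [Algebra K A]
    [LieRing V] [LieAlgebra K V] [Module A V] [LieRingModule V A]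
    [LieRinehartRing A V] [LieRinehartAlgebra K A V] (x : Fin n → A) (del : Fin n → V) : Prop where
  lie_x : ∀ i j, ⁅del i, x j⁆ = if i = j then 1 else 0
  sum_smul : ∀ η : V, ∑ i, ⁅η, x i⁆ • del i = η
  cotangent : ∀ c ∈ KaehlerDifferential.ideal K A, ∃ a : Fin n → A,
    c - ∑ i, a i • delta K (x i) ∈ KaehlerDifferential.ideal K A ^ 2

theorem deltaPow_zero (x : Fin n → A) : deltaPow K x 0 = 1 := by simp [deltaPow]

theorem deltaPow_add_single (x : Fin n → A) (s : Fin n →₀ ℕ) (i : Fin n) :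
    deltaPow K x (s + Finsupp.single i 1) = deltaPow K x s * delta K (x i) := by
  simp only [deltaPow, Finsupp.add_apply, pow_add, Finset.prod_mul_distrib]
  congr 1
  rw [Finset.prod_eq_single i]
  · simp [delta]
  · intro b _ hb
    simp [Finsupp.single_eq_of_ne hb]
  · simp

theorem exists_eq_add_single {s : Fin n →₀ ℕ} (hs : s ≠ 0) :
    ∃ t i, s = t + Finsupp.single i 1 := by
  obtain ⟨i, hi⟩ := Finsupp.ne_iff.1 hs
  refine ⟨s - Finsupp.single i 1, i, (tsub_add_cancel_of_le ?_).symm⟩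
  rw [Finsupp.single_le_iff]
  exact Nat.one_le_iff_ne_zero.2 hi

theorem sum_add_single (s : Fin n →₀ ℕ) (i : Fin n) :
    ∑ j, (s + Finsupp.single i 1 : Fin n →₀ ℕ) j = ∑ j, s j + 1 := by
  simp only [Finsupp.add_apply, Finset.sum_add_distrib]
  rw [← Finsupp.degree_eq_sum (Finsupp.single i 1), Finsupp.degree_single]

/-- Induction on the degree |s|, so that monomials and iterated derivatives can be built one
variable at a time. -/
theorem finsupp_single_induction {p : (Fin n →₀ ℕ) → Prop} (h0 : p 0)
    (h1 : ∀ s i, p s → p (s + Finsupp.single i 1)) (s : Fin n →₀ ℕ) : p s := by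
  induction hd : ∑ i, s i generalizing s with
  | zero =>
    have : s = 0 := by
      ext i
      exact Finset.sum_eq_zero_iff.1 hd i (Finset.mem_univ i)
    exact this ▸ h0
  | succ d ih =>
    have hs : s ≠ 0 := by rintro rfl; simp at hd
    obtain ⟨t, i, rfl⟩ := exists_eq_add_single hs
    refine h1 t i (ih t ?_)
    rw [sum_add_single] at hd
    omega

/-- Iterated derivatives are ordered products in a noncommutative ring, so adding one more factor
means commuting it past the later ones. -/
theorem list_ofFn_prod_update {M : Type*} [Monoid M] {n : ℕ} (a : Fin n → M)
    (ha : ∀ i j, Commute (a i) (a j)) (s : Fin n → ℕ) (i : Fin n) :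
    (List.ofFn fun k => a k ^ (s k + if k = i then 1 else 0)).prod =
      (List.ofFn fun k => a k ^ s k).prod * a i := by
  induction n with
  | zero => exact i.elim0
  | succ n ih =>
    rw [List.ofFn_succ, List.ofFn_succ, List.prod_cons, List.prod_cons]
    induction i using Fin.cases with
    | zero =>
      have hc : Commute (a 0) (List.ofFn fun k : Fin n => a k.succ ^ s k.succ).prod := by
        refine Commute.list_prod_right _ _ fun y hy => ?_
        obtain ⟨k, rfl⟩ := (List.mem_ofFn' _ _).1 hy
        exact (ha _ _).pow_right _
      simp only [Fin.succ_ne_zero, if_false, add_zero, if_true, pow_succ, mul_assoc]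
      rw [hc.eq]
    | succ i =>
      have := ih (fun k => a k.succ) (fun _ _ => ha _ _) (fun k => s k.succ) i
      simp only [Fin.succ_inj, (Fin.succ_ne_zero _).symm, if_false, add_zero] at this ⊢
      rw [this, mul_assoc]

/-- The iterated derivative `∂^s`. -/
def derPow (K : Type u) {A : Type v} {V : Type w} [Field K] [CommRing A] [Algebra K A]
    [LieRing V] [LieAlgebra K V] [Module A V] [LieRingModule V A]
    [LieRinehartRing A V] [LieRinehartAlgebra K A V] (del : Fin n → V) (s : Fin n →₀ ℕ) :
    Module.End K A :=
  (List.ofFn fun i => (LieModule.toEnd K V A (del i)) ^ s i).prod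

/-- The coefficient at `X^s` of the Taylor expansion of an element of `A ⊗ A` along the diagonal. -/
def taylorCoeff (K : Type u) {A : Type v} {V : Type w} [Field K] [CommRing A] [Algebra K A]
    [LieRing V] [LieAlgebra K V] [Module A V] [LieRingModule V A]
    [LieRinehartRing A V] [LieRinehartAlgebra K A V] (del : Fin n → V) (s : Fin n →₀ ℕ)
    (c : A ⊗[K] A) : A :=
  ((∏ i, (s i)! : ℕ) : K)⁻¹ •
    Algebra.TensorProduct.lmul' K ((derPow K del s).baseChange A c)

theorem taylorCoeff_one_tmul (del : Fin n → V) (s : Fin n →₀ ℕ) (f : A) :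
    taylorCoeff K del s (1 ⊗ₜ f) = MvPowerSeries.coeff s (taylor K del f) := by
  simp only [taylorCoeff, LinearMap.baseChange_tmul, Algebra.TensorProduct.lmul'_apply_tmul,
    one_mul]
  rfl

theorem taylorCoeff_sub (del : Fin n → V) (s : Fin n →₀ ℕ) (c d : A ⊗[K] A) :
    taylorCoeff K del s (c - d) = taylorCoeff K del s c - taylorCoeff K del s d := by
  simp only [taylorCoeff, map_sub, smul_sub]

theorem taylorCoeff_zero (del : Fin n → V) (c : A ⊗[K] A) :
    taylorCoeff K del 0 c = Algebra.TensorProduct.lmul' K c := by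
  have : derPow (A := A) K del 0 = 1 := by
    rw [derPow]
    simp
  rw [taylorCoeff, this, Module.End.one_eq_id, LinearMap.baseChange_id]
  simp

/-- The Taylor polynomial of degree less than `m`. -/
def taylorPoly (x : Fin n → A) (del : Fin n → V) (m : ℕ) (c : A ⊗[K] A) : A ⊗[K] A :=
  ∑ d ∈ Finset.range m, ∑ s ∈ Finset.univ.finsuppAntidiag d,
    taylorCoeff K del s c • deltaPow K x s

namespace IsFrame

variable {x : Fin n → A} {del : Fin n → V} (hx : IsFrame K x del)
include hx

/-- A field is determined by its values on the coordinates, and the bracket kills each of these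
because the functions ∂_i(x_k) are constants. -/
theorem lie_del (i j : Fin n) : ⁅del i, del j⁆ = 0 := by
  rw [← hx.sum_smul ⁅del i, del j⁆]
  refine Finset.sum_eq_zero fun k _ => ?_
  rw [lie_lie, hx.lie_x, hx.lie_x]
  split_ifs <;> simp [lie_one']

theorem commute (i j : Fin n) :
    Commute (LieModule.toEnd K V A (del i)) (LieModule.toEnd K V A (del j)) := by
  ext a
  have := lie_lie (del i) (del j) a
  rw [hx.lie_del, zero_lie, eq_comm, sub_eq_zero] at this
  exact this

theorem derPow_add_single (s : Fin n →₀ ℕ) (i : Fin n) :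
    derPow K del (s + Finsupp.single i 1) =
      derPow K del s * LieModule.toEnd K V A (del i) := by
  rw [derPow, derPow, ← list_ofFn_prod_update _ hx.commute s i]
  congr! 4 with k
  rw [Finsupp.add_apply, Finsupp.single_apply]
  congr 1
  simp [eq_comm]

/-- The power rule. The truncated subtraction is harmless: where it truncates, the factor `s i` is
zero. -/
theorem rightDer_deltaPow (i : Fin n) (s : Fin n →₀ ℕ) :
    rightDer K (del i) (deltaPow K x s) = (s i) • deltaPow K x (s - Finsupp.single i 1) := by
  induction s using finsupp_single_induction with
  | h0 => rw [deltaPow_zero, rightDer_one]; simp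
  | h1 s k ih =>
    rw [deltaPow_add_single, rightDer_mul, rightDer_delta, hx.lie_x, ih]
    rcases eq_or_ne i k with rfl | h
    · rw [if_pos rfl, ← Algebra.TensorProduct.one_def, mul_one, add_tsub_cancel_right,
        Finsupp.add_apply, Finsupp.single_eq_same, add_smul, one_smul, add_comm]
      congr 1
      rcases Nat.eq_zero_or_pos (s i) with h0 | h0
      · simp [h0]
      · rw [smul_mul_assoc, ← deltaPow_add_single, tsub_add_cancel_of_le]
        rw [Finsupp.single_le_iff]; exact h0
    · rw [if_neg h, TensorProduct.tmul_zero, mul_zero, zero_add, Finsupp.add_apply,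
        Finsupp.single_eq_of_ne h, add_zero]
      rcases Nat.eq_zero_or_pos (s i) with h0 | h0
      · simp [h0]
      · rw [smul_mul_assoc, ← deltaPow_add_single, tsub_add_eq_add_tsub]
        rw [Finsupp.single_le_iff]; exact h0

/-- The Euler operator is a derivation, so its eigenvalue on Δ^m modulo Δ^(m+1) follows from the
case m = 1. There only the class in Δ / Δ^2 matters, and the operator fixes the spanning elements
δ(x_i). -/
theorem euler_mem (m : ℕ) {c : A ⊗[K] A} (hc : c ∈ KaehlerDifferential.ideal K A ^ m) :
    ∑ i, delta K (x i) * rightDer K (del i) c - (m : A ⊗[K] A) * c ∈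
      KaehlerDifferential.ideal K A ^ (m + 1) := by
  have hprod : ∀ a b : A ⊗[K] A, ∑ i, delta K (x i) * rightDer K (del i) (a * b) =
      a * (∑ i, delta K (x i) * rightDer K (del i) b) +
        (∑ i, delta K (x i) * rightDer K (del i) a) * b := by
    intro a b
    simp only [rightDer_mul, Finset.mul_sum, Finset.sum_mul, ← Finset.sum_add_distrib]
    exact Finset.sum_congr rfl fun i _ => by ring
  have hzero : ∀ a : A ⊗[K] A, ∑ i, delta K (x i) * rightDer K (del i) a ∈
      KaehlerDifferential.ideal K A := fun a =>
    sum_mem fun i _ => Ideal.mul_mem_right _ _ (delta_mem _)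
  have hone : ∀ a ∈ KaehlerDifferential.ideal K A,
      ∑ i, delta K (x i) * rightDer K (del i) a - a ∈ KaehlerDifferential.ideal K A ^ 2 := by
    intro a ha
    obtain ⟨b, hb⟩ := hx.cotangent a ha
    have h1 : ∑ i, delta K (x i) * rightDer K (del i) (∑ j, b j • delta K (x j)) =
        ∑ j, b j • delta K (x j) := by
      refine Finset.sum_congr rfl fun i _ => ?_
      rw [map_sum, Finset.sum_eq_single i]
      · rw [map_smul, rightDer_delta, hx.lie_x, if_pos rfl, ← Algebra.TensorProduct.one_def,
          mul_smul_comm, mul_one]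
      · intro j _ hj
        rw [map_smul, rightDer_delta, hx.lie_x, if_neg hj.symm, TensorProduct.tmul_zero, smul_zero]
      · simp
    -- The error lies in Δ^2: differentiation brings it to Δ, and the factor δ(x_i) returns it to
    -- Δ^2.
    have h2 : ∑ i, delta K (x i) * rightDer K (del i) (a - ∑ j, b j • delta K (x j)) ∈
        KaehlerDifferential.ideal K A ^ 2 := by
      refine sum_mem fun i _ => ?_
      rw [pow_two]
      refine Ideal.mul_mem_mul (delta_mem _) ?_
      simpa using rightDer_mem (del i) 1 hb
    simp only [map_sub, mul_sub, Finset.sum_sub_distrib, h1] at h2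
    convert sub_mem h2 hb using 1
    ring
  induction m generalizing c with
  | zero => simpa using hzero c
  | succ m ih =>
    rw [pow_succ] at hc
    induction hc using Submodule.mul_induction_on' with
    | mem_mul_mem a ha b hb =>
      have e : ∑ i, delta K (x i) * rightDer K (del i) (a * b) - ((m + 1 : ℕ) : A ⊗[K] A) * (a * b) =
          a * (∑ i, delta K (x i) * rightDer K (del i) b - b) +
          (∑ i, delta K (x i) * rightDer K (del i) a - (m : A ⊗[K] A) * a) * b := by
        rw [hprod]; push_cast; ring
      rw [e]
      refine add_mem ?_ ?_
      · have := Ideal.mul_mem_mul ha (hone b hb)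
        rwa [← pow_add] at this
      · have := Ideal.mul_mem_mul (ih ha) hb
        rwa [← pow_succ] at this
    | add c hc d hd h h' =>
      simp only [map_add, mul_add, Finset.sum_add_distrib]
      convert add_mem h h' using 1
      ring

/-- Integration in the Δ-adic filtration. Once c is known to be in Δ^m, the Euler operator sends it
to m c modulo Δ^(m+1), and also into Δ^(m+1) by the assumption on derivatives. Dividing by m gains
one power. -/
theorem mem_pow_succ [CharZero K] (m : ℕ) {c : A ⊗[K] A}
    (hc : c ∈ KaehlerDifferential.ideal K A)
    (h : ∀ i, rightDer K (del i) c ∈ KaehlerDifferential.ideal K A ^ m) :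
    c ∈ KaehlerDifferential.ideal K A ^ (m + 1) := by
  induction m with
  | zero => simpa using hc
  | succ m ih =>
    have h0 := ih fun i => Ideal.pow_le_pow_right (Nat.le_succ m) (h i)
    have h1 := hx.euler_mem (m + 1) h0
    have h2 : ∑ i, delta K (x i) * rightDer K (del i) c ∈
        KaehlerDifferential.ideal K A ^ (m + 1 + 1) :=
      sum_mem fun i _ => by
        rw [pow_succ']
        exact Ideal.mul_mem_mul (delta_mem _) (h i)
    have h3 : ((m + 1 : ℕ) : A ⊗[K] A) * c ∈ KaehlerDifferential.ideal K A ^ (m + 1 + 1) := by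
      simpa using sub_mem h2 h1
    have h4 := Ideal.mul_mem_left _ (algebraMap K (A ⊗[K] A) ((m + 1 : ℕ) : K)⁻¹) h3
    rwa [← mul_assoc, ← map_natCast (algebraMap K (A ⊗[K] A)), ← map_mul,
      inv_mul_cancel₀ (Nat.cast_ne_zero.2 (Nat.succ_ne_zero m)), map_one, one_mul] at h4

theorem baseChange_derPow_add_single (s : Fin n →₀ ℕ) (i : Fin n) (c : A ⊗[K] A) :
    (derPow K del (s + Finsupp.single i 1)).baseChange A c =
      (derPow K del s).baseChange A (rightDer K (del i) c) := by
  rw [hx.derPow_add_single, Module.End.mul_eq_comp, LinearMap.baseChange_comp]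
  rfl

theorem taylorCoeff_add_single [CharZero K] (s : Fin n →₀ ℕ) (i : Fin n) (c : A ⊗[K] A) :
    (s i + 1) • taylorCoeff K del (s + Finsupp.single i 1) c =
      taylorCoeff K del s (rightDer K (del i) c) := by
  rw [taylorCoeff, taylorCoeff, hx.baseChange_derPow_add_single, ← Nat.cast_smul_eq_nsmul K,
    smul_smul]
  congr 1
  have : (∏ k, ((s + Finsupp.single i 1 : Fin n →₀ ℕ) k)!) = (∏ k, (s k)!) * (s i + 1) := by
    rw [← Finset.prod_erase_mul _ _ (Finset.mem_univ i),
      ← Finset.prod_erase_mul (f := fun k => (s k)!) _ (Finset.mem_univ i)]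
    rw [Finsupp.add_apply, Finsupp.single_eq_same, Nat.factorial_succ, mul_assoc,
      mul_comm (s i + 1)]
    congr 1
    refine Finset.prod_congr rfl fun k hk => ?_
    rw [Finsupp.add_apply, Finsupp.single_eq_of_ne (Finset.ne_of_mem_erase hk), add_zero]
  rw [this, Nat.cast_mul, mul_inv, mul_comm, mul_assoc, inv_mul_cancel₀, mul_one]
  exact Nat.cast_ne_zero.2 (Nat.succ_ne_zero _)

/-- Each derivative costs one power of Δ. Fewer than m derivatives leave at least one power, which
multiplication A ⊗ A → A kills. -/
theorem taylorCoeff_eq_zero (s : Fin n →₀ ℕ) {m : ℕ} (hs : ∑ i, s i < m) {c : A ⊗[K] A}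
    (hc : c ∈ KaehlerDifferential.ideal K A ^ m) : taylorCoeff K del s c = 0 := by
  have key : ∀ (s : Fin n →₀ ℕ) (c : A ⊗[K] A) (k : ℕ),
      c ∈ KaehlerDifferential.ideal K A ^ (k + ∑ i, s i) →
      (derPow K del s).baseChange A c ∈ KaehlerDifferential.ideal K A ^ k := by
    intro s
    induction s using finsupp_single_induction with
    | h0 =>
      intro c k hc
      have : derPow (A := A) K del 0 = 1 := by simp [derPow]
      rw [this, Module.End.one_eq_id, LinearMap.baseChange_id]
      simpa using hc
    | h1 s i ih =>
      intro c k hc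
      rw [hx.baseChange_derPow_add_single]
      refine ih _ k (rightDer_mem _ _ ?_)
      rwa [sum_add_single, ← add_assoc] at hc
  have h1 : (derPow K del s).baseChange A c ∈ KaehlerDifferential.ideal K A := by
    have := key s c 1 (Ideal.pow_le_pow_right (by omega) hc)
    rwa [pow_one] at this
  have h2 : Algebra.TensorProduct.lmul' K ((derPow K del s).baseChange A c) = 0 := h1
  rw [taylorCoeff, h2, smul_zero]

/-- Term by term: monomials without the i-th variable die, and the others are reindexed by adding
one to the i-th exponent, the factorials absorbing the factor from the power rule. -/
theorem rightDer_taylorPoly [CharZero K] (m : ℕ) (i : Fin n) (c : A ⊗[K] A) :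
    rightDer K (del i) (taylorPoly x del (m + 1) c) = taylorPoly x del m (rightDer K (del i) c) := by
  have h0 : rightDer K (del i) (deltaPow K x 0) = 0 := by rw [deltaPow_zero, rightDer_one]
  rw [taylorPoly, taylorPoly, Finset.sum_range_succ', Finset.finsuppAntidiag_zero,
    Finset.sum_singleton, map_add, map_smul, h0, smul_zero, add_zero, map_sum]
  refine Finset.sum_congr rfl fun d _ => ?_
  rw [map_sum]
  symm
  refine Finset.sum_of_injOn (fun s => s + Finsupp.single i 1) ?_ ?_ ?_ ?_
  · exact fun s _ t _ h => add_right_cancel h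
  · intro s hs
    simp only [Finset.mem_coe, Finset.mem_finsuppAntidiag] at hs ⊢
    refine ⟨?_, Finset.subset_univ _⟩
    exact (sum_add_single s i).trans (congrArg (· + 1) hs.1)
  · intro s hs hs'
    rw [map_smul, hx.rightDer_deltaPow]
    have : s i = 0 := by
      by_contra h
      refine hs' ⟨s - Finsupp.single i 1, ?_, ?_⟩
      · have e : s - Finsupp.single i 1 + Finsupp.single i 1 = s :=
          tsub_add_cancel_of_le (by rw [Finsupp.single_le_iff]; exact Nat.one_le_iff_ne_zero.2 h)
        simp only [Finset.mem_coe, Finset.mem_finsuppAntidiag] at hs ⊢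
        refine ⟨?_, Finset.subset_univ _⟩
        have h1 := hs.1
        rw [← e] at h1
        exact Nat.succ_injective ((sum_add_single _ i).symm.trans h1)
      · exact tsub_add_cancel_of_le
          (by rw [Finsupp.single_le_iff]; exact Nat.one_le_iff_ne_zero.2 h)
    rw [this, zero_smul, smul_zero]
  · intro s _
    rw [map_smul, hx.rightDer_deltaPow, add_tsub_cancel_right, ← hx.taylorCoeff_add_single,
      Finsupp.add_apply, Finsupp.single_eq_same, smul_assoc, smul_comm]

/-- Taylor's formula along the diagonal. -/
theorem sub_taylorPoly_mem [CharZero K] (m : ℕ) (c : A ⊗[K] A) :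
    c - taylorPoly x del m c ∈ KaehlerDifferential.ideal K A ^ m := by
  induction m generalizing c with
  | zero => simp
  | succ m ih =>
    -- The remainder vanishes on the diagonal, and its derivatives are the remainders of the
    -- derivatives of c at order m.
    refine hx.mem_pow_succ m ?_ fun i => ?_
    · change Algebra.TensorProduct.lmul' K _ = 0
      rw [taylorPoly, Finset.sum_range_succ', Finset.finsuppAntidiag_zero, Finset.sum_singleton,
        map_sub, map_add, lmul_smul, deltaPow_zero, map_one, mul_one, taylorCoeff_zero, map_sum,
        Finset.sum_eq_zero, zero_add, sub_self]
      intro d _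
      rw [map_sum]
      refine Finset.sum_eq_zero fun s hs => ?_
      rw [lmul_smul]
      have h1 := deltaPow_mem (K := K) x s
      rw [show ∑ i, s i = d + 1 from (Finset.mem_finsuppAntidiag.1 hs).1] at h1
      have h2 : deltaPow K x s ∈ KaehlerDifferential.ideal K A :=
        Ideal.pow_le_self (Nat.succ_ne_zero d) h1
      rw [show Algebra.TensorProduct.lmul' K (deltaPow K x s) = 0 from h2, mul_zero]
    · rw [map_sub, hx.rightDer_taylorPoly]
      exact ih _

end IsFrame
end Frame

/-! ### Jets as power series in the coordinate differences. -/

section JetFrame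

variable {K : Type u} {A : Type v} {V : Type w} [Field K] [CommRing A] [Algebra K A]
  [LieRing V] [LieAlgebra K V] [Module A V] [LieRingModule V A]
  [LieRinehartRing A V] [LieRinehartAlgebra K A V] {n : ℕ}

/-- The truncation of `F(δ(x))` in degrees less than `m`. -/
def truncSeries (K : Type u) {A : Type v} [Field K] [CommRing A] [Algebra K A] (x : Fin n → A)
    (F : MvPowerSeries (Fin n) A) (m : ℕ) : A ⊗[K] A :=
  ∑ d ∈ Finset.range m, ∑ s ∈ Finset.univ.finsuppAntidiag d,
    MvPowerSeries.coeff s F • deltaPow K x s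

theorem Jet.ofSeries_val (x : Fin n → A) (F : MvPowerSeries (Fin n) A) (η : V) (m : ℕ) :
    (Jet.ofSeries (K := K) x F η).val m =
      Submodule.Quotient.mk (truncSeries K x F m • Smash.mk K 1 η) := by
  simp only [truncSeries, Finset.sum_smul, smul_assoc]
  rfl

theorem Jet.ofSmash_val (z : Smash K A V) (m : ℕ) :
    (Jet.ofSmash K A V z).val m = Submodule.Quotient.mk z := rfl

theorem Jet.ofSeries_sub (x : Fin n → A) (F G : MvPowerSeries (Fin n) A) (η : V) :
    Jet.ofSeries (K := K) x (F - G) η = Jet.ofSeries x F η - Jet.ofSeries x G η := by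
  ext m
  rw [AdicCompletion.val_sub_apply, ofSeries_val, ofSeries_val, ofSeries_val,
    ← Submodule.Quotient.mk_sub, ← sub_smul]
  simp only [truncSeries, map_sub, sub_smul, Finset.sum_sub_distrib]

/-- Δ^0 is the whole ring, so level 0 of a jet carries no information. This covers the level where
truncations are empty sums. -/
instance : Subsingleton (Smash K A V ⧸ Smash.filtration K A V 0) := by
  rw [Submodule.Quotient.subsingleton_iff]
  simp [Smash.filtration]

theorem Jet.ofSeries_C (x : Fin n → A) (a : A) (η : V) :
    Jet.ofSeries (K := K) x (MvPowerSeries.C a) η = a • Jet.ofSmash K A V (Smash.mk K 1 η) := by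
  ext m
  rcases m with _ | m
  · exact Subsingleton.elim _ _
  rw [← map_smul, ofSeries_val, ofSmash_val]
  congr 1
  rw [truncSeries, Finset.sum_range_succ', Finset.finsuppAntidiag_zero, Finset.sum_singleton,
    Finset.sum_eq_zero, zero_add, MvPowerSeries.coeff_zero_C, deltaPow_zero, smul_assoc, one_smul]
  intro d _
  refine Finset.sum_eq_zero fun s hs => ?_
  classical
  rw [MvPowerSeries.coeff_C, if_neg, zero_smul]
  rintro rfl
  simpa using (Finset.mem_finsuppAntidiag.1 hs).1

theorem Jet.lie_ofSmash_val (z : Smash K A V) (y : Jet K A V) (m : ℕ) {b : Smash K A V}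
    (hb : y.val m = Submodule.Quotient.mk b) :
    ⁅Jet.ofSmash K A V z, y⁆.val m = Submodule.Quotient.mk ⁅z, b⁆ := by
  rw [lie_val, hb, ofSmash_val, Smash.quotBracket_mk]

theorem Jet.ofSmash_lie (z z' : Smash K A V) :
    ⁅Jet.ofSmash K A V z, Jet.ofSmash K A V z'⁆ = Jet.ofSmash K A V ⁅z, z'⁆ := by
  ext m
  exact lie_ofSmash_val z _ m rfl

theorem Jet.anchor_ofSmash (z : Smash K A V) :
    Jet.anchor K A V (Jet.ofSmash K A V z) = Smash.anchor K A V z :=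
  Jet.anchor_eq _ one_pos (ofSmash_val z 1)

theorem Smash.diag_smul (η : V) (a : A) (c : A ⊗[K] A) :
    Smash.diag η (a • c) = a • Smash.diag η c + ⁅η, a⁆ • c := by
  have h : ∀ (b : A) (d : A ⊗[K] A), b • d = (b ⊗ₜ[K] (1 : A)) * d := fun b d => by
    rw [Algebra.smul_def]; rfl
  rw [h, Smash.diag_mul, Smash.diag_tmul, lie_one', TensorProduct.tmul_zero, add_zero, ← h, ← h]

variable (K) in
/-- The coordinates of an element of `A # V` in the basis `1 # del j`. -/
def smashCoord (a : A) : Smash K A V →ₗ[K] A ⊗[K] A :=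
  TensorProduct.map LinearMap.id (R := K)
    { toFun := fun η : V => ⁅η, a⁆
      map_add' := fun _ _ => add_lie _ _ _
      map_smul' := fun _ _ => smul_lie _ _ _ }

theorem smashCoord_mk (a f : A) (η : V) :
    smashCoord K a (Smash.mk K f η) = f ⊗ₜ ⁅η, a⁆ := rfl

theorem smashCoord_smul (a : A) (c : A ⊗[K] A) (z : Smash K A V) :
    smashCoord K a (c • z) = c * smashCoord K a z := by
  induction z using Smash.induction with
  | h0 => simp
  | h2 x y h h' => rw [smul_add, map_add, h, h', map_add, mul_add]
  | h1 f η =>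
    induction c using TensorProduct.induction_on with
    | zero => simp
    | add x y h h' => rw [add_smul, map_add, h, h', add_mul]
    | tmul b b' =>
      rw [Smash.tmul_smul_mk, smashCoord_mk, smashCoord_mk, LieRinehartRing.lie_smul_eq_mul,
        Algebra.TensorProduct.tmul_mul_tmul]

/-- By A ⊗ A-linearity, a coordinate inherits the Δ-adic order, which reduces jets to Taylor
expansion in A ⊗ A. -/
theorem smashCoord_mem (a : A) (m : ℕ) {z : Smash K A V} (hz : z ∈ Smash.filtration K A V m) :
    smashCoord K a z ∈ KaehlerDifferential.ideal K A ^ m := by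
  induction hz using Submodule.smul_induction_on' with
  | smul c hc y hy =>
    rw [smashCoord_smul]
    exact Ideal.mul_mem_right _ _ hc
  | add x hx y hy h h' => rw [map_add]; exact add_mem h h'

namespace IsFrame

variable {x : Fin n → A} {del : Fin n → V} (hx : IsFrame K x del)
include hx

theorem sum_smashCoord (z : Smash K A V) :
    ∑ j, smashCoord K (x j) z • Smash.mk K 1 (del j) = z := by
  induction z using Smash.induction with
  | h0 => simp
  | h2 y z h h' => simp only [map_add, add_smul, Finset.sum_add_distrib, h, h']
  | h1 f η =>
    simp only [smashCoord_mk, Smash.tmul_smul_mk, mul_one]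
    conv_rhs => rw [← hx.sum_smul η]
    exact (TensorProduct.tmul_sum _ _ _).symm

/-- Every jet is a combination of power series in the coordinates. -/
theorem exists_series [CharZero K] (y : Jet K A V) :
    ∃ F : Fin n → MvPowerSeries (Fin n) A, y = ∑ j, Jet.ofSeries x (F j) (del j) := by
  choose a ha using Jet.exists_rep y
  -- Representatives at different levels agree modulo Δ^(|s|+1), which the coefficient at X^s does
  -- not see.
  have hcoeff : ∀ (j : Fin n) (s : Fin n →₀ ℕ) (m : ℕ), ∑ i, s i < m →
      taylorCoeff K del s (smashCoord K (x j) (a (∑ i, s i + 1))) =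
        taylorCoeff K del s (smashCoord K (x j) (a m)) := by
    intro j s m hm
    have h1 := Jet.rep_of_le y (Nat.succ_le_of_lt hm) (ha m)
    rw [ha, Submodule.Quotient.eq] at h1
    rw [← sub_eq_zero, ← taylorCoeff_sub, ← map_sub]
    exact hx.taylorCoeff_eq_zero s (Nat.lt_succ_self _) (smashCoord_mem _ _ h1)
  -- The level |s| + 1 is the first that determines the coefficient at X^s; level |s| would not
  -- suffice.
  let F : Fin n → MvPowerSeries (Fin n) A := fun j s =>
    taylorCoeff K del s (smashCoord K (x j) (a (∑ i, s i + 1)))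
  refine ⟨F, ?_⟩
  ext m
  have htr : ∀ j, truncSeries K x (F j) m = taylorPoly x del m (smashCoord K (x j) (a m)) := by
    intro j
    refine Finset.sum_congr rfl fun d hd => Finset.sum_congr rfl fun s hs => ?_
    congr 1
    refine hcoeff j s m ?_
    rw [show ∑ i, s i = d from (Finset.mem_finsuppAntidiag.1 hs).1]
    exact Finset.mem_range.1 hd
  have hval : ∀ j, (Jet.ofSeries (K := K) x (F j) (del j)).val m = Submodule.Quotient.mk
      (taylorPoly x del m (smashCoord K (x j) (a m)) • Smash.mk K 1 (del j)) := fun j => by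
    rw [Jet.ofSeries_val, htr]
  rw [AdicCompletion.val_sum_apply, Finset.sum_congr rfl fun j _ => hval j, ha]
  refine Eq.trans ?_ (map_sum (Submodule.mkQ _) _ _)
  refine (Submodule.Quotient.eq _).2 ?_
  -- In the basis 1 # ∂_j, the difference has Taylor remainders of order m as coordinates.
  nth_rewrite 1 [← hx.sum_smashCoord (a m)]
  rw [← Finset.sum_sub_distrib]
  refine sum_mem fun j _ => ?_
  rw [← sub_smul]
  exact Submodule.smul_mem_smul (hx.sub_taylorPoly_mem m _) trivial

/-- The jet `1 # f ∂_j` is given by the Taylor series of `f`. -/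
theorem ofSmash_smul_del [CharZero K] (f : A) (j : Fin n) :
    Jet.ofSmash K A V (Smash.mk K 1 (f • del j)) = Jet.ofSeries x (taylor K del f) (del j) := by
  ext m
  rw [Jet.ofSeries_val, Jet.ofSmash_val, Submodule.Quotient.eq]
  have h1 : truncSeries K x (taylor K del f) m = taylorPoly x del m (1 ⊗ₜ f) := by
    simp only [truncSeries, taylorPoly, taylorCoeff_one_tmul]
  have h2 : Smash.mk K 1 (f • del j) = ((1 : A) ⊗ₜ[K] f) • Smash.mk K (1 : A) (del j) := by
    rw [Smash.tmul_smul_mk, one_mul]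
  rw [h1, h2, ← sub_smul]
  exact Submodule.smul_mem_smul (hx.sub_taylorPoly_mem m _) trivial

/-- Coordinate differences are invariant under simultaneous translation of both points: ∂_i(x_j) is
a constant, the same on the left and on the right. -/
theorem diag_delta (i j : Fin n) : Smash.diag (K := K) (del i) (delta K (x j)) = 0 := by
  rw [delta, map_sub, Smash.diag_tmul, Smash.diag_tmul, lie_one', TensorProduct.tmul_zero,
    TensorProduct.zero_tmul, hx.lie_x]
  split_ifs <;> simp

theorem diag_deltaPow (i : Fin n) (s : Fin n →₀ ℕ) :
    Smash.diag (K := K) (del i) (deltaPow K x s) = 0 := by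
  induction s using finsupp_single_induction with
  | h0 =>
    rw [deltaPow_zero, Algebra.TensorProduct.one_def, Smash.diag_tmul, lie_one',
      TensorProduct.tmul_zero, TensorProduct.zero_tmul, add_zero]
  | h1 s k ih => rw [deltaPow_add_single, Smash.diag_mul, ih, hx.diag_delta, mul_zero, zero_mul,
      add_zero]

theorem lie_mk_del (i j : Fin n) :
    ⁅Smash.mk K (1 : A) (del i), Smash.mk K (1 : A) (del j)⁆ = 0 := by
  rw [Smash.mk_lie_mk, lie_one', lie_one', hx.lie_del, mul_zero]
  simp only [Smash.mk, TensorProduct.tmul_zero, TensorProduct.zero_tmul]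
  exact (add_zero _).trans (sub_self _)

/-- The bracket with 1 # ∂_i acts through the diagonal derivation. This kills the monomials in δ(x)
and so differentiates only the coefficients, matching condition (1). -/
theorem lie_ofSeries (i j : Fin n) (F G : MvPowerSeries (Fin n) A)
    (hG : ∀ s, MvPowerSeries.coeff s G = ⁅del i, MvPowerSeries.coeff s F⁆) :
    ⁅Jet.ofSmash K A V (Smash.mk K 1 (del i)), Jet.ofSeries (K := K) x F (del j)⁆ =
      Jet.ofSeries x G (del j) := by
  ext m
  rw [Jet.lie_ofSmash_val _ _ m (Jet.ofSeries_val (K := K) x F (del j) m), Jet.ofSeries_val]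
  congr 1
  have h1 : Smash.nabla K A V (Smash.mk K 1 (del j)) (Smash.mk K 1 (del i)) = 0 := by
    change Smash.mk K ((1 : A) * ⁅del j, (1 : A)⁆) (del i) = 0
    rw [lie_one', mul_zero]
    exact TensorProduct.zero_tmul _ _
  rw [Smash.mk_lie_smul, hx.lie_mk_del, h1, smul_zero, smul_zero, add_zero, add_zero, sub_zero,
    ← Algebra.TensorProduct.one_def, one_mul]
  congr 1
  simp only [truncSeries, map_sum, Smash.diag_smul, hx.diag_deltaPow, hG, smul_zero, zero_add]

theorem lie_ofSmash_del (i j : Fin n) :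
    ⁅Jet.ofSmash K A V (Smash.mk K 1 (del i)), Jet.ofSmash K A V (Smash.mk K 1 (del j))⁆ = 0 := by
  rw [Jet.ofSmash_lie, hx.lie_mk_del, map_zero]

end IsFrame
end JetFrame

/-! ### From partial derivatives and virtual jets to an action of all jets. -/

section FrameAction

variable {K : Type u} {A : Type v} {V : Type w} [Field K] [CommRing A] [Algebra K A]
  [LieRing V] [LieAlgebra K V] [Module A V] [LieRingModule V A]
  [LieRinehartRing A V] [LieRinehartAlgebra K A V] {n : ℕ}

/-- The jet `1 # η`. -/
def Jet.ofField (K : Type u) (A : Type v) {V : Type w} [Field K] [CommRing A] [Algebra K A]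
    [LieRing V] [LieAlgebra K V] [Module A V] [LieRingModule V A]
    [LieRinehartRing A V] [LieRinehartAlgebra K A V] (η : V) : Jet K A V :=
  Jet.ofSmash K A V (Smash.mk K 1 η)

theorem Jet.anchor_ofField (η : V) : Jet.anchor K A V (Jet.ofField K A η) = η := by
  rw [ofField, anchor_ofSmash, Smash.anchor_mk, one_smul]

variable {x : Fin n → A} {del : Fin n → V}

/-- The virtual part of a jet: the difference between the jet and the combination of the jets
`1 # del i` with the same anchor. -/
def IsFrame.virtualPart (hx : IsFrame K x del) : Jet K A V →ₗ[A] VirtualJet K A V where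
  toFun y := ⟨y - ∑ i, ⁅y, x i⁆ • Jet.ofField K A (del i), LinearMap.mem_ker.2 (by
    simp only [map_sub, map_sum, map_smul, Jet.anchor_ofField]
    exact sub_eq_zero.2 (hx.sum_smul _).symm)⟩
  map_add' y z := Subtype.ext (by
    change _ = (y - _) + (z - _)
    simp only [add_lie, add_smul, Finset.sum_add_distrib]
    abel)
  map_smul' a y := Subtype.ext (by
    change _ = a • (y - _)
    simp only [LieRinehartRing.lie_smul_eq_mul, mul_smul, smul_sub, Finset.smul_sum])

theorem IsFrame.virtualPart_val (hx : IsFrame K x del) (y : Jet K A V) :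
    (hx.virtualPart y : Jet K A V) = y - ∑ i, ⁅y, x i⁆ • Jet.ofField K A (del i) := rfl

theorem VirtualJet.lie_fun (l : VirtualJet K A V) (a : A) : ⁅(l : Jet K A V), a⁆ = 0 := by
  rw [Jet.lie_apply, LinearMap.mem_ker.1 l.2, zero_lie]

theorem IsFrame.virtualPart_coe (hx : IsFrame K x del) (l : VirtualJet K A V) :
    hx.virtualPart (l : Jet K A V) = l := by
  refine Subtype.ext ?_
  rw [hx.virtualPart_val]
  simp [VirtualJet.lie_fun]

theorem IsFrame.lie_ofField_x (hx : IsFrame K x del) (i j : Fin n) :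
    ⁅Jet.ofField K A (del i), x j⁆ = if i = j then (1 : A) else 0 := by
  rw [Jet.lie_apply, Jet.anchor_ofField, hx.lie_x]

theorem IsFrame.virtualPart_ofField_del (hx : IsFrame K x del) (i : Fin n) :
    hx.virtualPart (Jet.ofField K A (del i)) = 0 := by
  refine Subtype.ext ?_
  rw [hx.virtualPart_val]
  simp [hx.lie_ofField_x]

variable {E : Type*} [AddCommGroup E] [Module K E] [Module A E] [IsScalarTower K A E]

/-- Operators `P i` (the partial derivatives) and an action `J` of virtual jets on an `A`-module
which are compatible with each other. -/
structure IsFrameAction (x : Fin n → A) (del : Fin n → V) (P : Fin n → Module.End K E)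
    (J : VirtualJet K A V →ₗ[A] Module.End A E) : Prop where
  leibniz : ∀ i (a : A) e, P i (a • e) = a • P i e + ⁅del i, a⁆ • e
  comm : ∀ i j e, P i (P j e) = P j (P i e)
  lie : ∀ l l' e, J ⁅l, l'⁆ e = J l (J l' e) - J l' (J l e)
  lie_del : ∀ i (l k : VirtualJet K A V),
    (k : Jet K A V) = ⁅Jet.ofField K A (del i), (l : Jet K A V)⁆ →
    ∀ e, P i (J l e) - J l (P i e) = J k e

/-- The action of a jet `y`, that is, of `∑ i, y(x_i) (1 # del i)` plus a virtual jet. -/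
def IsFrame.jetOp (hx : IsFrame K x del) (P : Fin n → Module.End K E)
    (J : VirtualJet K A V →ₗ[A] Module.End A E) : Jet K A V →ₗ[K] Module.End K E where
  toFun y :=
    { toFun := fun e => ∑ i, ⁅y, x i⁆ • P i e + J (hx.virtualPart y) e
      map_add' := fun e e' => by
        simp only [map_add, smul_add, Finset.sum_add_distrib]; abel
      map_smul' := fun r e => by
        simp only [map_smul, RingHom.id_apply, smul_add, Finset.smul_sum]
        congr 1
        · exact Finset.sum_congr rfl fun i _ => smul_comm _ _ _
        · exact LinearMap.map_smul_of_tower _ r e }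
  map_add' y z := by
    ext e
    simp only [LinearMap.coe_mk, AddHom.coe_mk, LinearMap.add_apply, map_add, add_lie, add_smul,
      Finset.sum_add_distrib]
    abel
  map_smul' r y := by
    ext e
    simp only [LinearMap.coe_mk, AddHom.coe_mk, LinearMap.smul_apply, RingHom.id_apply, smul_add,
      Finset.smul_sum, ← algebraMap_smul A r, map_smul, LieRinehartRing.lie_smul_eq_mul, mul_smul]

namespace IsFrame

variable (hx : IsFrame K x del) {P : Fin n → Module.End K E}
    {J : VirtualJet K A V →ₗ[A] Module.End A E}

theorem jetOp_apply (y : Jet K A V) (e : E) :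
    hx.jetOp P J y e = ∑ i, ⁅y, x i⁆ • P i e + J (hx.virtualPart y) e := rfl

theorem jetOp_smul (a : A) (y : Jet K A V) (e : E) :
    hx.jetOp P J (a • y) e = a • hx.jetOp P J y e := by
  simp only [jetOp_apply, smul_add, Finset.smul_sum, LieRinehartRing.lie_smul_eq_mul, mul_smul,
    map_smul, LinearMap.smul_apply]

theorem jetOp_coe (l : VirtualJet K A V) (e : E) : hx.jetOp P J (l : Jet K A V) e = J l e := by
  rw [jetOp_apply, hx.virtualPart_coe]
  simp [VirtualJet.lie_fun]

theorem jetOp_ofField_del (i : Fin n) (e : E) :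
    hx.jetOp P J (Jet.ofField K A (del i)) e = P i e := by
  rw [jetOp_apply, hx.virtualPart_ofField_del]
  simp [hx.lie_ofField_x]

include hx in
/-- Jets are generated by the virtual ones and the jets `1 # del i`. -/
theorem jet_induction {p : Jet K A V → Prop} (h0 : ∀ l : VirtualJet K A V, p l)
    (h1 : ∀ i, p (Jet.ofField K A (del i))) (hadd : ∀ y z, p y → p z → p (y + z))
    (hsmul : ∀ (a : A) y, p y → p (a • y)) (y : Jet K A V) : p y := by
  have : y = (hx.virtualPart y : Jet K A V) + ∑ i, ⁅y, x i⁆ • Jet.ofField K A (del i) := by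
    rw [hx.virtualPart_val, sub_add_cancel]
  rw [this]
  refine hadd _ _ (h0 _) ?_
  exact Finset.sum_induction _ p hadd (h0 0) fun i _ => hsmul _ _ (h1 i)

/-- The rule is A-linear in the jet, so it suffices to check generators: virtual jets act A-linearly
and kill functions, and the operators P satisfy it by assumption. -/
theorem jetOp_leibniz (h : IsFrameAction x del P J) (y : Jet K A V) (a : A) (e : E) :
    hx.jetOp P J y (a • e) = a • hx.jetOp P J y e + ⁅y, a⁆ • e := by
  induction y using hx.jet_induction with
  | h0 l => rw [jetOp_coe, jetOp_coe, map_smul, VirtualJet.lie_fun, zero_smul, add_zero]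
  | h1 i => rw [jetOp_ofField_del, jetOp_ofField_del, h.leibniz, Jet.lie_apply, Jet.anchor_ofField]
  | hadd y z hy hz =>
    simp only [map_add, LinearMap.add_apply, hy, hz, add_lie, smul_add, add_smul]; abel
  | hsmul b y hy =>
    rw [jetOp_smul, jetOp_smul, hy, LieRinehartRing.lie_smul_eq_mul, smul_add, smul_comm, mul_smul]

/-- Compatibility with the bracket of a pair is stable under exchange, sums and multiplication by
functions; the last uses the Leibniz rule on both sides. So only pairs of generators remain, and
these are the conditions in `IsFrameAction`. -/
theorem jetOp_lie (h : IsFrameAction x del P J) (y z : Jet K A V) (e : E) :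
    hx.jetOp P J ⁅y, z⁆ e =
      hx.jetOp P J y (hx.jetOp P J z e) - hx.jetOp P J z (hx.jetOp P J y e) := by
  have key : ∀ y z, (∀ e, hx.jetOp P J ⁅y, z⁆ e =
      hx.jetOp P J y (hx.jetOp P J z e) - hx.jetOp P J z (hx.jetOp P J y e)) →
      ∀ e, hx.jetOp P J ⁅z, y⁆ e =
      hx.jetOp P J z (hx.jetOp P J y e) - hx.jetOp P J y (hx.jetOp P J z e) := by
    intro y z hyz e
    rw [← lie_skew, map_neg, LinearMap.neg_apply, hyz, neg_sub]
  have hadd : ∀ y z z', (∀ e, hx.jetOp P J ⁅y, z⁆ e =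
      hx.jetOp P J y (hx.jetOp P J z e) - hx.jetOp P J z (hx.jetOp P J y e)) →
      (∀ e, hx.jetOp P J ⁅y, z'⁆ e =
      hx.jetOp P J y (hx.jetOp P J z' e) - hx.jetOp P J z' (hx.jetOp P J y e)) →
      ∀ e, hx.jetOp P J ⁅y, z + z'⁆ e =
      hx.jetOp P J y (hx.jetOp P J (z + z') e) - hx.jetOp P J (z + z') (hx.jetOp P J y e) := by
    intro y z z' h1 h2 e
    simp only [lie_add, map_add, LinearMap.add_apply, h1, h2]; abel
  have hsmul : ∀ (a : A) y z, (∀ e, hx.jetOp P J ⁅y, z⁆ e =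
      hx.jetOp P J y (hx.jetOp P J z e) - hx.jetOp P J z (hx.jetOp P J y e)) →
      ∀ e, hx.jetOp P J ⁅y, a • z⁆ e =
      hx.jetOp P J y (hx.jetOp P J (a • z) e) - hx.jetOp P J (a • z) (hx.jetOp P J y e) := by
    intro a y z h1 e
    simp only [LieRinehartRing.leibniz_smul_right, map_add, LinearMap.add_apply, jetOp_smul, h1,
      hx.jetOp_leibniz h, smul_sub]
    abel
  revert e
  induction z using hx.jet_induction with
  | hadd z z' hz hz' => exact hadd y z z' hz hz'
  | hsmul a z hz => exact hsmul a y z hz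
  | h0 l =>
    refine key _ _ ?_
    induction y using hx.jet_induction with
    | hadd z z' hz hz' => exact hadd _ z z' hz hz'
    | hsmul a z hz => exact hsmul a _ z hz
    | h0 l' =>
      intro e
      have : ⁅(l : Jet K A V), (l' : Jet K A V)⁆ = ((⁅l, l'⁆ : VirtualJet K A V) : Jet K A V) := rfl
      rw [this]
      simp only [jetOp_coe, h.lie]
    | h1 i =>
      refine key _ _ fun e => ?_
      -- Virtual jets form an ideal, so the mixed bracket is again virtual and J acts on it.
      have hv : ⁅Jet.ofField K A (del i), (l : Jet K A V)⁆ ∈ VirtualJet K A V :=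
        LinearMap.mem_ker.2 (by rw [Jet.anchor_lie, LinearMap.mem_ker.1 l.2, lie_zero])
      have := h.lie_del i l ⟨_, hv⟩ rfl e
      rw [hx.jetOp_coe ⟨_, hv⟩ e, jetOp_coe, jetOp_coe, jetOp_ofField_del, jetOp_ofField_del, this]
  | h1 i =>
    refine key _ _ ?_
    induction y using hx.jet_induction with
    | hadd z z' hz hz' => exact hadd _ z z' hz hz'
    | hsmul a z hz => exact hsmul a _ z hz
    | h0 l =>
      intro e
      have hv : ⁅Jet.ofField K A (del i), (l : Jet K A V)⁆ ∈ VirtualJet K A V :=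
        LinearMap.mem_ker.2 (by rw [Jet.anchor_lie, LinearMap.mem_ker.1 l.2, lie_zero])
      have := h.lie_del i l ⟨_, hv⟩ rfl e
      rw [hx.jetOp_coe ⟨_, hv⟩ e, jetOp_coe, jetOp_coe, jetOp_ofField_del, jetOp_ofField_del, this]
    | h1 j =>
      intro e
      have : ⁅Jet.ofField K A (del i), Jet.ofField K A (del j)⁆ = 0 := hx.lie_ofSmash_del i j
      rw [this]
      simp only [jetOp_ofField_del, map_zero, LinearMap.zero_apply, h.comm i j, sub_self]

/-- The module structure over the strong enveloping algebra of jets. -/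
def envelopingAct (h : IsFrameAction x del P J) :
    StrongEnveloping K A (Jet K A V) →ₐ[K] Module.End K E :=
  StrongEnveloping.lift (Algebra.lsmul K K E) (hx.jetOp P J)
    (fun y z => LinearMap.ext fun e => hx.jetOp_lie h y z e)
    (fun y a => LinearMap.ext fun e => (hx.jetOp_leibniz h y a e).trans (add_comm _ _))
    (fun a y => LinearMap.ext fun e => (hx.jetOp_smul a y e).symm)

theorem envelopingAct_ofFun (h : IsFrameAction x del P J) (a : A) (e : E) :
    hx.envelopingAct h (StrongEnveloping.ofFun K A _ a) e = a • e :=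
  LinearMap.congr_fun (StrongEnveloping.lift_ofFun _ _ _ _ _ a) e

theorem envelopingAct_ofLie (h : IsFrameAction x del P J) (y : Jet K A V) (e : E) :
    hx.envelopingAct h (StrongEnveloping.ofLie K A _ y) e = hx.jetOp P J y e :=
  LinearMap.congr_fun (StrongEnveloping.lift_ofLie _ _ _ _ _ y) e

end IsFrame

theorem StrongEnveloping.induction {L : Type*} [LieRing L] [LieAlgebra K L] [Module A L]
    [LieRingModule L A] {p : StrongEnveloping K A L → Prop}
    (hscalar : ∀ r, p (algebraMap K _ r))
    (hfun : ∀ a, p (ofFun K A L a)) (hlie : ∀ y, p (ofLie K A L y))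
    (hadd : ∀ s t, p s → p t → p (s + t)) (hmul : ∀ s t, p s → p t → p (s * t))
    (s : StrongEnveloping K A L) : p s := by
  obtain ⟨q, rfl⟩ := RingQuot.mkAlgHom_surjective K (StrongRel K A L) s
  induction q using FreeAlgebra.induction with
  | grade0 r => rw [AlgHom.commutes]; exact hscalar r
  | grade1 z =>
    rcases z with a | y
    · exact hfun a
    · exact hlie y
  | mul a b ha hb => rw [map_mul]; exact hmul _ _ ha hb
  | add a b ha hb => rw [map_add]; exact hadd _ _ ha hb

end FrameAction

/-! ### Derivations of algebraic extensions and the cotangent space of the diagonal. -/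

section Algebraic

variable {K : Type u} {A : Type v} [Field K] [CommRing A] [Algebra K A] {n : ℕ}

/-- Since D is S-linear, p(f) = 0 gives p'(f) D(f) = 0. If p'(f) is nonzero, D(f) = 0 because A is a
domain; otherwise p' is an annihilating polynomial of smaller degree, nonzero in characteristic 0
because p is not constant. -/
theorem derivation_eq_zero_of_isAlgebraic [CharZero K] [IsDomain A] (S : Subalgebra K A)
    (D : Derivation K A A) (hD : ∀ a ∈ S, D a = 0) {f : A} (hf : IsAlgebraic S f) : D f = 0 := by
  have : CharZero A := charZero_of_injective_algebraMap (algebraMap K A).injective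
  let D' : Derivation S A A := Derivation.mk'
    { toFun := D
      map_add' := map_add D
      map_smul' := fun r a => by
        change D ((r : A) * a) = (r : A) * D a
        rw [Derivation.leibniz, hD r r.2, smul_zero, add_zero, smul_eq_mul] }
    (fun a b => D.leibniz a b)
  obtain ⟨p, hp, hpf⟩ := hf
  induction hd : p.natDegree using Nat.strong_induction_on generalizing p with
  | _ d ih =>
    by_cases hp' : Polynomial.aeval f (Polynomial.derivative p) = 0
    · by_cases h0 : p.natDegree = 0
      · rw [Polynomial.eq_C_of_natDegree_eq_zero h0, Polynomial.aeval_C] at hpf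
        refine absurd ?_ hp
        rw [Polynomial.eq_C_of_natDegree_eq_zero h0, Polynomial.C_eq_zero]
        exact Subtype.ext hpf
      · exact ih _ (hd ▸ Polynomial.natDegree_derivative_lt h0) _
          (fun h => h0 (Polynomial.derivative_eq_zero.1 h)) hp' rfl
    · have h1 := D'.map_aeval p f
      rw [hpf, map_zero, smul_eq_mul] at h1
      exact (mul_eq_zero.1 h1.symm).resolve_left hp'

theorem derivation_eq_zero_of_adjoin [CharZero K] [IsDomain A] (x : Fin n → A)
    (hx : ∀ f : A, IsAlgebraic (Algebra.adjoin K (Set.range x)) f) (D : Derivation K A A)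
    (hD : ∀ i, D (x i) = 0) : D = 0 := by
  ext f
  refine derivation_eq_zero_of_isAlgebraic _ D (fun a ha => ?_) (hx f)
  have : Set.EqOn D (0 : Derivation K A A) (Algebra.adjoin K (Set.range x)) := by
    refine Derivation.eqOn_adjoin ?_
    rintro _ ⟨i, rfl⟩
    exact hD i
  exact this ha

theorem derivation_sum_apply {ι : Type*} (s : Finset ι) (D : ι → Derivation K A A) (a : A) :
    (∑ i ∈ s, D i) a = ∑ i ∈ s, D i a := by
  have := map_sum (Derivation.coeFnAddMonoidHom (R := K) (A := A) (M := A)) D s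
  exact (congrFun this a).trans (Finset.sum_apply _ _ _)

/-- The quotient Δ / Δ^2 is the module of differentials. Formal smoothness makes it projective, so
its elements are separated by linear forms, that is, by derivations. Each derivation is a
combination of the ∂_i, hence ω = ∑ ∂_i(ω) dx_i can be tested on derivations. -/
theorem cotangent_eq_span [Algebra.FormallySmooth K A] (x : Fin n → A)
    (del : Fin n → Derivation K A A) (hdel : ∀ i j, del i (x j) = if i = j then 1 else 0)
    (huniq : ∀ D : Derivation K A A, (∀ i, D (x i) = 0) → D = 0) (c : A ⊗[K] A)
    (hc : c ∈ KaehlerDifferential.ideal K A) : ∃ a : Fin n → A,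
      c - ∑ i, a i • delta K (x i) ∈ KaehlerDifferential.ideal K A ^ 2 := by
  have hproj : Module.Projective A Ω[A⁄K] := inferInstance
  have hD : ∀ D : Derivation K A A, D = ∑ i, D (x i) • del i := fun D => by
    rw [← sub_eq_zero]
    refine huniq _ fun j => ?_
    rw [Derivation.sub_apply, derivation_sum_apply, Finset.sum_eq_single j]
    · simp [hdel]
    · intro i _ hi
      simp [hdel, hi]
    · simp
  have hω : ∀ ω : Ω[A⁄K], ω = ∑ i, (del i).liftKaehlerDifferential ω • KaehlerDifferential.D K A (x i) := by
    intro ω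
    rw [← sub_eq_zero, ← Module.forall_dual_apply_eq_zero_iff A]
    intro φ
    obtain ⟨D, rfl⟩ : ∃ D : Derivation K A A, D.liftKaehlerDifferential = φ :=
      ⟨φ.compDer (KaehlerDifferential.D K A), Derivation.liftKaehlerDifferential_unique _ _ (by
        ext; simp)⟩
    have h1 : D.liftKaehlerDifferential =
        ∑ i, D (x i) • (del i).liftKaehlerDifferential := by
      refine Derivation.liftKaehlerDifferential_unique _ _ ?_
      ext a
      have := congrArg (fun E : Derivation K A A => E a) (hD D)
      simpa [LinearMap.sum_apply, derivation_sum_apply] using this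
    rw [map_sub, map_sum, sub_eq_zero]
    conv_lhs => rw [h1]
    simp [LinearMap.sum_apply, mul_comm]
  obtain ⟨a, h⟩ : ∃ a : Fin n → A, (KaehlerDifferential.ideal K A).toCotangent ⟨c, hc⟩ =
      ∑ i, a i • KaehlerDifferential.D K A (x i) := ⟨_, hω _⟩
  refine ⟨a, ?_⟩
  have h2 : ∑ i, a i • KaehlerDifferential.D K A (x i) =
      (KaehlerDifferential.ideal K A).toCotangent
        (∑ i, a i • (⟨delta K (x i), delta_mem _⟩ : KaehlerDifferential.ideal K A)) := by
    rw [map_sum]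
    refine Finset.sum_congr rfl fun i _ => ?_
    rw [LinearMap.map_smul_of_tower]
    rfl
  have h3 := (Ideal.toCotangent_eq _).1 (h.trans h2)
  simpa using h3

end Algebraic

/-! ### Étale charts provide frames. -/

section ChartFrame

variable {K : Type u} [Field K] {X : Scheme.{u}} [X.Over (Spec (CommRingCat.of K))]

theorem germ_resFun [IsIntegral X] {U W : X.Opens} [Nonempty U] [Nonempty W] (h : W ≤ U)
    (f : Γ(X, U)) : X.germToFunctionField W (resFun K h f) = X.germToFunctionField U f :=
  X.presheaf.germ_res_apply (homOfLE h) _ _ f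

theorem nonempty_of_nontrivial {U : X.Opens} [Nontrivial Γ(X, U)] : Nonempty U := by
  by_contra h
  rw [not_nonempty_iff] at h
  have hU : U = ⊥ := by
    ext p
    exact ⟨fun hp => h.elim ⟨p, hp⟩, fun hp => hp.elim⟩
  subst hU
  exact not_subsingleton Γ(X, (⊥ : X.Opens)) inferInstance

theorem subsingleton_of_isEmpty {U : X.Opens} (h : ¬ Nonempty U) : Subsingleton Γ(X, U) := by
  by_contra h'
  rw [not_subsingleton_iff_nontrivial] at h'
  exact h nonempty_of_nontrivial

/-- A section over a smaller open set is a quotient of sections over an affine open set. -/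
theorem exists_mul_resFun_eq [IsIntegral X] {U W : X.Opens} (hU : IsAffineOpen U) [Nonempty U]
    [Nonempty W] (h : W ≤ U) (f : Γ(X, W)) :
    ∃ a b : Γ(X, U), b ≠ 0 ∧ resFun K h b * f = resFun K h a := by
  have := functionField_isFractionRing_of_isAffineOpen X U hU
  obtain ⟨a, b, hb, hab⟩ := IsFractionRing.div_surjective (A := Γ(X, U)) (X.germToFunctionField W f)
  have hb0 : b ≠ 0 := nonZeroDivisors.ne_zero hb
  refine ⟨a, b, hb0, X.germToFunctionField_injective W ?_⟩
  rw [map_mul, germ_resFun, germ_resFun, ← hab]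
  change algebraMap Γ(X, U) X.functionField b * _ = algebraMap Γ(X, U) X.functionField a
  rw [mul_div_cancel₀]
  exact (map_ne_zero_iff _ (X.germToFunctionField_injective U)).2 hb0

theorem formallySmooth_sections [Smooth (X ↘ Spec (CommRingCat.of K))] {U : X.Opens}
    (hU : IsAffineOpen U) : Algebra.FormallySmooth K Γ(X, U) := by
  have h1 := Smooth.smooth_appLE (X ↘ Spec (CommRingCat.of K)) (isAffineOpen_top _) hU le_top
  have h2 : (Scheme.ΓSpecIso (CommRingCat.of K)).inv.hom.Smooth := by
    refine RingHom.Smooth.of_bijective ?_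
    exact ConcreteCategory.bijective_of_isIso (Scheme.ΓSpecIso (CommRingCat.of K)).inv
  exact (h2.comp h1).formallySmooth

/-- A section f over a smaller nonempty open set satisfies b f = a with a, b from U and b nonzero.
The field kills a and b, so b η(f) = 0, and b can be cancelled on an integral scheme. -/
theorem VectorField.eq_zero_of_toDerivation [IsIntegral X] {U : X.Opens} (hU : IsAffineOpen U)
    [Nonempty U] (η : VectorField K U) (hη : η.toDerivation = 0) : η = 0 := by
  refine VectorField.ext' fun W f => ?_
  change η.1 W f = 0
  by_cases hW : Nonempty W.1
  · obtain ⟨a, b, hb, hab⟩ := exists_mul_resFun_eq (K := K) hU W.2 f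
    have hres : ∀ g : Γ(X, U), η.1 W (resFun K W.2 g) = 0 := fun g => by
      rw [← η.2 ⟨U, le_rfl⟩ W W.2 g]
      change resFun K _ (η.toDerivation g) = 0
      rw [hη, Derivation.zero_apply, map_zero]
    have h1 := congrArg (η.1 W) hab
    rw [Derivation.leibniz, hres, hres, smul_zero, add_zero, smul_eq_mul] at h1
    refine (mul_eq_zero.1 h1).resolve_left fun h0 => hb ?_
    refine X.germToFunctionField_injective U ?_
    rw [← germ_resFun (K := K) W.2, h0, map_zero, map_zero]
  · have := subsingleton_of_isEmpty hW
    exact Subsingleton.elim _ _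

namespace EtaleChart

variable {n : ℕ} {U : X.Opens} (c : EtaleChart K n U)

include c in
theorem nonempty : Nonempty U := by
  have : Nontrivial Γ(X, U) := c.algebraicIndependent.algebraMap_injective.nontrivial
  exact nonempty_of_nontrivial

/-- By algebraicity a derivation is determined by its values on the coordinates. This gives the
expansion of vector fields and, with formal smoothness, the span of the cotangent space. -/
theorem isFrame [CharZero K] [IsIntegral X] [Smooth (X ↘ Spec (CommRingCat.of K))] :
    IsFrame K c.x c.del := by
  have := c.nonempty
  have huniq : ∀ D : Derivation K Γ(X, U) Γ(X, U), (∀ i, D (c.x i) = 0) → D = 0 :=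
    derivation_eq_zero_of_adjoin c.x c.isAlgebraic
  have := formallySmooth_sections (K := K) c.isAffineOpen
  refine ⟨c.del_x, fun η => ?_, cotangent_eq_span c.x (fun i => (c.del i).toDerivation) c.del_x
    huniq⟩
  rw [← sub_eq_zero]
  refine VectorField.eq_zero_of_toDerivation c.isAffineOpen _ (huniq _ fun j => ?_)
  rw [← VectorField.lie_apply, sub_lie, sub_eq_zero, sum_lie, Finset.sum_eq_single j]
  · rw [LieRinehartRing.lie_smul_eq_mul, VectorField.lie_apply (c.del j), c.del_x, if_pos rfl,
      mul_one]
  · intro i _ hi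
    rw [LieRinehartRing.lie_smul_eq_mul, VectorField.lie_apply (c.del i), c.del_x, if_neg hi,
      mul_zero]
  · simp

end EtaleChart
end ChartFrame

/-! ### Coordinates on standard smooth algebras. -/

section EtaleCoordinates

/-- Derivations extend along formally étale morphisms. -/
theorem exists_derivation_extension (R S T : Type*) [CommRing R] [CommRing S] [CommRing T]
    [Algebra R S] [Algebra R T] [Algebra S T] [IsScalarTower R S T] [Algebra.FormallyEtale S T]
    (D : Derivation R S S) :
    ∃ D' : Derivation R T T, ∀ s, D' (algebraMap S T s) = algebraMap S T (D s) := by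
  -- For S → T formally étale, the differentials of T are the base change of those of S, so the
  -- linear form attached to D extends to T.
  let φ : T ⊗[S] Ω[S⁄R] →ₗ[T] T :=
    LinearMap.liftBaseChange T (Algebra.linearMap S T ∘ₗ D.liftKaehlerDifferential)
  refine ⟨(φ ∘ₗ (KaehlerDifferential.tensorKaehlerEquivOfFormallyEtale R S T).symm.toLinearMap).compDer
    (KaehlerDifferential.D R T), fun s => ?_⟩
  change φ ((KaehlerDifferential.tensorKaehlerEquivOfFormallyEtale R S T).symm
    (KaehlerDifferential.D R T (algebraMap S T s))) = _
  rw [KaehlerDifferential.tensorKaehlerEquivOfFormallyEtale_symm_D_algebraMap]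
  simp [φ]

/-- A nonzero r is regular on R, hence on the flat module A, so r · 1 cannot vanish. -/
theorem algebraMap_injective_of_flat (R A : Type*) [CommRing R] [IsDomain R] [CommRing A]
    [Nontrivial A] [Algebra R A] [Module.Flat R A] : Function.Injective (algebraMap R A) := by
  rw [injective_iff_map_eq_zero]
  intro r hr
  by_contra h
  have h1 := Module.Flat.isSMulRegular_of_isRegular (M := A) (IsRegular.of_ne_zero h)
  have h2 : r • (1 : A) = r • (0 : A) := by rw [smul_zero, Algebra.smul_def, hr, zero_mul]
  exact one_ne_zero (h1 h2)

/-- An étale algebra over a domain is algebraic. -/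
theorem isAlgebraic_of_etale (R A : Type u) [CommRing R] [IsDomain R] [CommRing A] [Algebra R A]
    [Algebra.Etale R A] (f : A) : IsAlgebraic R f := by
  have : Module.Flat R A := inferInstance
  -- An étale algebra over a field is finite, hence algebraic. By flatness A embeds in this base
  -- change, and denominators can be cleared.
  have hfin : Module.Finite (FractionRing R) (FractionRing R ⊗[R] A) :=
    Algebra.FormallyUnramified.finite_of_free _ _
  have hinj : Function.Injective
      (Algebra.TensorProduct.includeRight : A →ₐ[R] FractionRing R ⊗[R] A) :=
    Algebra.TensorProduct.includeRight_injective (IsFractionRing.injective R (FractionRing R))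
  rw [← isAlgebraic_algHom_iff _ hinj, IsFractionRing.isAlgebraic_iff R (FractionRing R)]
  exact Algebra.IsAlgebraic.isAlgebraic _

/-- A standard smooth algebra is étale over a polynomial ring in n variables. The images of the
variables are the coordinates: flatness makes them independent, étaleness makes A algebraic over
them, and partial derivatives extend along the étale map. -/
theorem exists_coordinates (K A : Type u) [Field K] [CommRing A] [IsDomain A] [Algebra K A] (n : ℕ)
    [Algebra.IsStandardSmoothOfRelativeDimension n K A] :
    ∃ (x : Fin n → A) (del : Fin n → Derivation K A A), AlgebraicIndependent K x ∧
      (∀ f : A, IsAlgebraic (Algebra.adjoin K (Set.range x)) f) ∧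
      ∀ i j, del i (x j) = if i = j then 1 else 0 := by
  obtain ⟨g, hg⟩ :=
    Algebra.IsStandardSmoothOfRelativeDimension.exists_etale_mvPolynomial n K A
  let _ : Algebra (MvPolynomial (Fin n) K) A := g.toRingHom.toAlgebra
  have : IsScalarTower K (MvPolynomial (Fin n) K) A :=
    IsScalarTower.of_algebraMap_eq fun r => (g.commutes r).symm
  have : Algebra.Etale (MvPolynomial (Fin n) K) A := hg
  have hinj : Function.Injective g := algebraMap_injective_of_flat (MvPolynomial (Fin n) K) A
  have hgx : g = MvPolynomial.aeval (fun i => g (MvPolynomial.X i)) :=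
    MvPolynomial.algHom_ext fun i => by simp
  have hx : AlgebraicIndependent K (fun i => g (MvPolynomial.X i)) := by
    change Function.Injective (MvPolynomial.aeval _)
    rw [← hgx]
    exact hinj
  choose D hD using fun i => exists_derivation_extension K (MvPolynomial (Fin n) K) A
    (MvPolynomial.pderiv i)
  refine ⟨fun i => g (MvPolynomial.X i), D, hx, fun f => ?_, fun i j => ?_⟩
  · obtain ⟨p, hp, hpf⟩ := isAlgebraic_of_etale (MvPolynomial (Fin n) K) A f
    let φ := hx.aevalEquiv
    refine ⟨p.map φ.toRingEquiv.toRingHom,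
      (Polynomial.map_ne_zero_iff φ.injective).2 hp, ?_⟩
    rw [Polynomial.aeval_def, Polynomial.eval₂_map, ← hpf, Polynomial.aeval_def]
    congr 1
    exact RingHom.ext fun q =>
      (hx.algebraMap_aevalEquiv q).trans (congrArg (fun ψ => ψ q) hgx.symm)
  · refine (hD i (MvPolynomial.X j)).trans ?_
    rw [MvPolynomial.pderiv_X]
    rcases eq_or_ne i j with rfl | h
    · simp
    · simp [h, h.symm]

end EtaleCoordinates

/-! ### Vector fields from derivations, and the basis of étale charts. -/

section ExtendDerivation

variable {K : Type u} [Field K] {X : Scheme.{u}} [X.Over (Spec (CommRingCat.of K))] [IsIntegral X]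

/-- A family of functions on nonempty open sets, all with the same image in the function field,
glues. -/
theorem exists_germ_eq_of_cover (z : X.functionField) (W : X.Opens) [Nonempty W]
    (h : ∀ p ∈ W, ∃ (B : X.Opens) (_ : Nonempty B) (g : Γ(X, B)), p ∈ B ∧ B ≤ W ∧
      X.germToFunctionField B g = z) : ∃ g : Γ(X, W), X.germToFunctionField W g = z := by
  choose B hB g hpB hBW hg using fun p : W => h p.1 p.2
  have hmem : ∀ (O : X.Opens), Nonempty O → genericPoint X ∈ O := fun O hO =>
    ((genericPoint_spec X).mem_open_set_iff O.isOpen).mpr (by simpa using hO)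
  obtain ⟨s, hs, -⟩ := X.sheaf.existsUnique_gluing' B W (fun p => homOfLE (hBW p))
    (fun p hp => TopologicalSpace.Opens.mem_iSup.2 ⟨⟨p, hp⟩, hpB ⟨p, hp⟩⟩) g (by
      intro p q
      -- All nonempty open sets share the generic point, so the overlap is nonempty and embeds its
      -- sections in the function field, where both sections equal z.
      have : Nonempty (B p ⊓ B q : X.Opens) :=
        ⟨⟨genericPoint X, hmem _ (hB p), hmem _ (hB q)⟩⟩
      refine X.germToFunctionField_injective (B p ⊓ B q) ?_
      exact ((X.presheaf.germ_res_apply (TopologicalSpace.Opens.infLELeft (B p) (B q)) _ _ (g p)).trans (hg p)).trans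
        ((X.presheaf.germ_res_apply (TopologicalSpace.Opens.infLERight (B p) (B q)) _ _ (g q)).trans (hg q)).symm)
  refine ⟨s, ?_⟩
  obtain ⟨p⟩ : Nonempty W := inferInstance
  rw [← hg p, ← hs p]
  exact (X.presheaf.germ_res_apply (homOfLE (hBW p)) _ _ s).symm

/-- Derivations of the functions on an affine open set are vector fields. -/
theorem exists_vectorField {U : X.Opens} (hU : IsAffineOpen U) [Nonempty U]
    (D : Derivation K Γ(X, U) Γ(X, U)) : ∃ η : VectorField K U, η.toDerivation = D := by
  have hfrac := functionField_isFractionRing_of_isAffineOpen X U hU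
  let _ : Algebra K X.functionField :=
    ((algebraMap Γ(X, U) X.functionField).comp (algebraMap K Γ(X, U))).toAlgebra
  have : IsScalarTower K Γ(X, U) X.functionField := IsScalarTower.of_algebraMap_eq' rfl
  have : Algebra.FormallyEtale Γ(X, U) X.functionField :=
    Algebra.FormallyEtale.of_isLocalization (nonZeroDivisors Γ(X, U))
  -- Extend D to the function field; the derivation on each W will be the restriction of this one,
  -- so compatibility is automatic.
  obtain ⟨D', hD'⟩ := exists_derivation_extension K Γ(X, U) X.functionField D
  have hDU : ∀ a : Γ(X, U), D' (X.germToFunctionField U a) = X.germToFunctionField U (D a) := hD'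
  -- Any local extension E of D agrees with D': sections on W are quotients of sections on U, where
  -- the two coincide.
  have hloc : ∀ (W : X.Opens) (h : W ≤ U) [Nonempty W] (E : Derivation K Γ(X, W) Γ(X, W)),
      (∀ a, E (resFun K h a) = resFun K h (D a)) →
      ∀ f, X.germToFunctionField W (E f) = D' (X.germToFunctionField W f) := by
    intro W h _ E hE f
    obtain ⟨a, b, hb, hab⟩ := exists_mul_resFun_eq (K := K) hU h f
    have hb' : X.germToFunctionField U b ≠ 0 :=
      (map_ne_zero_iff _ (X.germToFunctionField_injective U)).2 hb
    have h1 := congrArg (fun t => X.germToFunctionField W (E t)) hab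
    have h2 := congrArg (fun t => D' (X.germToFunctionField W t)) hab
    simp only [Derivation.leibniz, hE, map_add, map_mul, smul_eq_mul, germ_resFun, hDU] at h1 h2
    exact mul_left_cancel₀ hb' (add_right_cancel (h1.trans h2.symm))
  have hK : ∀ (W : X.Opens) (h : W ≤ U) [Nonempty W] (r : K) (f : Γ(X, W)),
      X.germToFunctionField W (r • f) = r • X.germToFunctionField W f := by
    intro W h _ r f
    rw [Algebra.smul_def, Algebra.smul_def, map_mul, ← (resFun K h).commutes r, germ_resFun]
    rfl
  -- D' preserves the sections on W: W is covered by basic open sets of U, to which D extends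
  -- because localizations are formally étale, and the local values glue.
  have hex : ∀ (W : X.Opens) (h : W ≤ U) [Nonempty W] (f : Γ(X, W)), ∃ g : Γ(X, W),
      X.germToFunctionField W g = D' (X.germToFunctionField W f) := by
    intro W h _ f
    refine exists_germ_eq_of_cover _ W fun p hp => ?_
    obtain ⟨s, hsW, hps⟩ := hU.exists_basicOpen_le ⟨p, hp⟩ (h hp)
    have hne : Nonempty (X.basicOpen s) := ⟨⟨p, hps⟩⟩
    let _ : Algebra Γ(X, U) Γ(X, X.basicOpen s) := (resFun K (X.basicOpen_le s)).toRingHom.toAlgebra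
    have : IsScalarTower K Γ(X, U) Γ(X, X.basicOpen s) :=
      IsScalarTower.of_algebraMap_eq fun r => ((resFun K (X.basicOpen_le s)).commutes r).symm
    have : IsLocalization.Away s Γ(X, X.basicOpen s) := hU.isLocalization_basicOpen s
    have : Algebra.FormallyEtale Γ(X, U) Γ(X, X.basicOpen s) :=
      Algebra.FormallyEtale.of_isLocalization (Submonoid.powers s)
    obtain ⟨E, hE⟩ := exists_derivation_extension K Γ(X, U) Γ(X, X.basicOpen s) D
    refine ⟨X.basicOpen s, hne, E (resFun K hsW f), hps, hsW, ?_⟩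
    rw [hloc _ (X.basicOpen_le s) E hE, germ_resFun]
  have hder : ∀ (W : {W : X.Opens // W ≤ U}), ∃ E : Derivation K Γ(X, W.1) Γ(X, W.1),
      ∀ [Nonempty W.1] f, X.germToFunctionField W.1 (E f) = D' (X.germToFunctionField W.1 f) := by
    intro W
    by_cases hW : Nonempty W.1
    · choose E hE using hex W.1 W.2
      have hinj := X.germToFunctionField_injective W.1
      let L : Γ(X, W.1) →ₗ[K] Γ(X, W.1) :=
        { toFun := E
          map_add' := fun f g => hinj (by rw [hE, map_add, map_add, map_add, hE, hE])
          map_smul' := fun r f => hinj (by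
            rw [hE, RingHom.id_apply, hK W.1 W.2, hK W.1 W.2, D'.map_smul, hE]) }
      refine ⟨Derivation.mk' L fun f g => hinj ?_, fun f => hE f⟩
      change X.germToFunctionField W.1 (E (f * g)) =
        X.germToFunctionField W.1 (f • E g + g • E f)
      simp only [smul_eq_mul, map_add, map_mul, hE, Derivation.leibniz]
    -- On the empty set there is nothing to satisfy, so the zero derivation serves.
    · exact ⟨0, fun f => absurd ‹_› hW⟩
  choose E hE using hder
  refine ⟨⟨E, fun W W' h f => ?_⟩, ?_⟩
  · by_cases hW' : Nonempty W'.1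
    · have hW : Nonempty W.1 := hW'.map fun p => ⟨p.1, h p.2⟩
      refine X.germToFunctionField_injective W'.1 ?_
      rw [germ_resFun, hE, hE, germ_resFun]
    · have := subsingleton_of_isEmpty hW'
      exact Subsingleton.elim _ _
  · ext a
    refine X.germToFunctionField_injective U ?_
    exact (hE ⟨U, le_rfl⟩ a).trans (hDU a)

/-- Étale charts form a basis of the topology. -/
theorem exists_etaleChart (n : ℕ)
    [SmoothOfRelativeDimension n (X ↘ Spec (CommRingCat.of K))] (W : X.Opens) {p : X}
    (hp : p ∈ W) : ∃ U : X.Opens, p ∈ U ∧ U ≤ W ∧ Nonempty (EtaleChart K n U) := by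
  obtain ⟨U₀, hU₀, V, hV, hpV, e, hstd⟩ :=
    SmoothOfRelativeDimension.exists_isStandardSmoothOfRelativeDimension (n := n)
      (f := X ↘ Spec (CommRingCat.of K)) p
  -- The spectrum of a field is a single point, so an open set containing an image point is
  -- everything.
  have htop : U₀ = ⊤ := by
    have : Subsingleton (Spec (CommRingCat.of K)) :=
      inferInstanceAs (Subsingleton (PrimeSpectrum K))
    ext q
    refine ⟨fun _ => trivial, fun _ => ?_⟩
    rw [Subsingleton.elim q ((X ↘ Spec (CommRingCat.of K)) p)]
    exact e hpV
  subst htop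
  obtain ⟨s, hsW, hps⟩ := hV.exists_basicOpen_le ⟨p, hp⟩ hpV
  refine ⟨X.basicOpen s, hps, hsW, ?_⟩
  have hne : Nonempty (X.basicOpen s) := ⟨⟨p, hps⟩⟩
  -- Shrinking to a basic open set inside W is a localization, which preserves standard smoothness
  -- and the relative dimension.
  have hstd' : RingHom.IsStandardSmoothOfRelativeDimension n
      ((X ↘ Spec (CommRingCat.of K)).appLE ⊤ (X.basicOpen s) le_top).hom := by
    have : IsLocalization.Away s Γ(X, X.basicOpen s) := hV.isLocalization_basicOpen s
    have h1 := (RingHom.isStandardSmoothOfRelativeDimension_stableUnderCompositionWithLocalizationAway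
      n).right Γ(X, X.basicOpen s) s _ hstd
    have h2 := Scheme.Hom.appLE_map (X ↘ Spec (CommRingCat.of K)) e
      (homOfLE (X.basicOpen_le s)).op
    rw [← h2]
    exact h1
  -- Change of base from Γ(Spec K) to K: an isomorphism has relative dimension 0, and dimensions
  -- add.
  have hstd'' : Algebra.IsStandardSmoothOfRelativeDimension n K Γ(X, X.basicOpen s) := by
    have h2 := hstd'.comp (RingHom.IsStandardSmoothOfRelativeDimension.equiv
      (Scheme.ΓSpecIso (CommRingCat.of K)).symm.commRingCatIsoToRingEquiv)
    rw [add_zero] at h2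
    exact h2
  obtain ⟨x, del, hx, halg, hdel⟩ := exists_coordinates K Γ(X, X.basicOpen s) n
  choose η hη using fun i => exists_vectorField (hV.basicOpen s) (del i)
  exact ⟨⟨hV.basicOpen s, x, hx, halg, η, fun i j => by rw [hη, hdel]⟩⟩

end ExtendDerivation

/-! ### Restriction of sections of a sheaf of modules. -/

section Restriction

variable {K : Type u} [Field K] {X : Scheme.{u}} [X.Over (Spec (CommRingCat.of K))]
  {M : X.Modules} {U W : X.Opens}

theorem resMod_add (h : W ≤ U) (m m' : Γ(M, U)) :
    resMod h (m + m') = resMod h m + resMod h m' := map_add (M.presheaf.map (homOfLE h).op).hom m m'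

theorem resMod_zero (h : W ≤ U) : resMod h (0 : Γ(M, U)) = 0 :=
  map_zero (M.presheaf.map (homOfLE h).op).hom

variable (K) in
theorem resMod_smul (h : W ≤ U) (f : Γ(X, U)) (m : Γ(M, U)) :
    resMod h (f • m) = resFun K h f • resMod h m :=
  Scheme.Modules.map_smul M (homOfLE h) f m

theorem resMod_resMod {W' : X.Opens} (h : W ≤ U) (h' : W' ≤ W) (m : Γ(M, U)) :
    resMod h' (resMod h m) = resMod (h'.trans h) m := by
  change (M.presheaf.map (homOfLE h).op ≫ M.presheaf.map (homOfLE h').op).hom m = _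
  rw [← M.presheaf.map_comp]
  rfl

theorem resMod_self (m : Γ(M, U)) : resMod le_rfl m = m := by
  change (M.presheaf.map (𝟙 _)).hom m = m
  rw [M.presheaf.map_id]
  rfl

/-- Sections of a sheaf of modules are vector spaces over the base field. -/
abbrev sectionModule (K : Type u) [Field K] {X : Scheme.{u}} [X.Over (Spec (CommRingCat.of K))]
    (M : X.Modules) (U : X.Opens) : Module K Γ(M, U) :=
  Module.compHom Γ(M, U) (algebraMap K Γ(X, U))

attribute [local instance] sectionModule

instance : IsScalarTower K Γ(X, U) Γ(M, U) where
  smul_assoc r a m := by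
    rw [Algebra.smul_def, mul_smul]
    rfl

end Restriction

attribute [local instance] sectionModule

/-! ### Commutation relations of differential operators. -/

section DiffOp

variable {K : Type u} [Field K] {A : Type u} [CommRing A] [Algebra K A]

theorem DiffOp.ofDerivation_mul_ofFun (D : Derivation K A A) (a : A) :
    DiffOp.ofDerivation K D * DiffOp.ofFun K a =
      DiffOp.ofFun K a * DiffOp.ofDerivation K D + DiffOp.ofFun K (D a) := by
  refine Subtype.ext (LinearMap.ext fun b => ?_)
  change D (a * b) = a * D b + D a * b
  rw [Derivation.leibniz, smul_eq_mul, smul_eq_mul, mul_comm b]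

theorem DiffOp.ofDerivation_comm (D E : Derivation K A A) (h : ∀ a, D (E a) = E (D a)) :
    DiffOp.ofDerivation K D * DiffOp.ofDerivation K E =
      DiffOp.ofDerivation K E * DiffOp.ofDerivation K D :=
  Subtype.ext (LinearMap.ext h)

end DiffOp

theorem AVLocal.induction {K : Type u} [Field K] {X : Scheme.{u}}
    [X.Over (Spec (CommRingCat.of K))] {U : X.Opens} {p : AVLocal K U → Prop}
    (hscalar : ∀ r, p (algebraMap K _ r)) (hfun : ∀ a, p (AVLocal.ofFun K U a))
    (hjet : ∀ y, p (AVLocal.ofJet K U y)) (hadd : ∀ s t, p s → p t → p (s + t))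
    (hmul : ∀ s t, p s → p t → p (s * t)) (s : AVLocal K U) : p s :=
  StrongEnveloping.induction hscalar hfun hjet hadd hmul s

/-! ### The action of `AV` in one chart and its compatibility with restriction. -/

section ChartAction

variable {K : Type u} [Field K] {X : Scheme.{u}} [X.Over (Spec (CommRingCat.of K))] {n : ℕ}
  {M : X.Modules} (C : ChargedDModule K n M) {U : X.Opens} (c : EtaleChart K n U)

namespace ChargedDModule

theorem diffAct_leibniz (i : Fin n) (a : Γ(X, U)) (m : Γ(M, U)) :
    C.diffAct c (DiffOp.ofDerivation K (c.del i).toDerivation) (a • m) =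
      a • C.diffAct c (DiffOp.ofDerivation K (c.del i).toDerivation) m +
        (c.del i).toDerivation a • m := by
  have h := congrArg (fun P => C.diffAct c P m)
    (DiffOp.ofDerivation_mul_ofFun (c.del i).toDerivation a)
  simp only [map_mul, map_add] at h
  rw [← C.diffAct_fun c a m, ← C.diffAct_fun c a, ← C.diffAct_fun c ((c.del i).toDerivation a)]
  exact h

/-- The action of the partial derivatives of a chart. -/
def partialOp (i : Fin n) : Module.End K Γ(M, U) where
  toFun m := C.diffAct c (DiffOp.ofDerivation K (c.del i).toDerivation) m
  map_add' := map_add _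
  map_smul' r m := by
    change C.diffAct c _ (algebraMap K Γ(X, U) r • m) = algebraMap K Γ(X, U) r • _
    -- The action of differential operators is only given as additive; linearity over K follows
    -- since derivations kill constants.
    rw [C.diffAct_leibniz, Derivation.map_algebraMap, zero_smul, add_zero]

variable [CharZero K] [IsIntegral X] [Smooth (X ↘ Spec (CommRingCat.of K))]

/-- The constant terms are the coefficients of the anchor in the basis ∂_j. They vanish for a
virtual jet, as evaluating the zero anchor on each coordinate shows. -/
theorem _root_.AVSheaf.EtaleChart.exists_virtualJet (l : VirtualJetField K U) :
    ∃ (F : Fin n → MvPowerSeries (Fin n) Γ(X, U)) (hF : ∀ j, MvPowerSeries.constantCoeff (F j) = 0),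
      l = ∑ j, c.virtualJet (F j) (hF j) j := by
  obtain ⟨F, hF⟩ := c.isFrame.exists_series (l : JetField K U)
  have h0 : ∀ j, MvPowerSeries.constantCoeff (F j) = 0 := by
    intro j
    have h1 := LinearMap.mem_ker.1 l.2
    rw [hF, map_sum] at h1
    simp only [Jet.anchor_ofSeries] at h1
    have h2 := congrArg (fun η : VectorField K U => ⁅η, c.x j⁆) h1
    simp only [sum_lie, zero_lie, LieRinehartRing.lie_smul_eq_mul, c.isFrame.lie_x] at h2
    simpa using h2
  refine ⟨F, h0, Subtype.ext ?_⟩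
  rw [hF, AddSubmonoidClass.coe_finsetSum]
  rfl

/-- The condition for mixed brackets is known only for F ∂/∂X_j. Every virtual jet is a finite sum
of these, and their brackets with 1 # ∂_i are computed by `IsFrame.lie_ofSeries`. -/
theorem isFrameAction :
    IsFrameAction c.x c.del (C.partialOp c) (C.jetAct c.isAffineOpen) where
  leibniz i a m := C.diffAct_leibniz c i a m
  comm i j m := by
    have h := congrArg (fun P => C.diffAct c P m) (DiffOp.ofDerivation_comm
      (c.del i).toDerivation (c.del j).toDerivation
      fun a => LinearMap.congr_fun (c.isFrame.commute i j).eq a)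
    simp only [map_mul] at h
    exact h
  lie := C.jetAct_lie c.isAffineOpen
  lie_del i l l' h m := by
    obtain ⟨F, hF, rfl⟩ := c.exists_virtualJet l
    have hl' : l' = ∑ j, c.virtualJet (c.coeffDeriv i (F j))
        (c.constantCoeff_coeffDeriv i (hF j)) j := by
      refine Subtype.ext ?_
      rw [h, AddSubmonoidClass.coe_finsetSum, AddSubmonoidClass.coe_finsetSum, lie_sum]
      refine Finset.sum_congr rfl fun j _ => ?_
      exact c.isFrame.lie_ofSeries i j (F j) _ fun s => rfl
    rw [hl']
    simp only [map_sum, LinearMap.sum_apply]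
    rw [← Finset.sum_sub_distrib]
    exact Finset.sum_congr rfl fun j _ => C.diffAct_comm c i j (F j) (hF j) m

/-- The action of `AV` in a chart. -/
def chartAct : AVLocal K U →ₐ[K] Module.End K Γ(M, U) :=
  c.isFrame.envelopingAct (C.isFrameAction c)

theorem chartAct_ofFun (f : Γ(X, U)) (m : Γ(M, U)) :
    C.chartAct c (AVLocal.ofFun K U f) m = f • m :=
  c.isFrame.envelopingAct_ofFun (C.isFrameAction c) f m

theorem chartAct_ofJet (y : JetField K U) (m : Γ(M, U)) :
    C.chartAct c (AVLocal.ofJet K U y) m =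
      c.isFrame.jetOp (C.partialOp c) (C.jetAct c.isAffineOpen) y m :=
  c.isFrame.envelopingAct_ofLie (C.isFrameAction c) y m

theorem chartAct_ofJet_virtual (l : VirtualJetField K U) (m : Γ(M, U)) :
    C.chartAct c (AVLocal.ofJet K U (l : JetField K U)) m = C.jetAct c.isAffineOpen l m :=
  (C.chartAct_ofJet c _ m).trans (c.isFrame.jetOp_coe l m)

theorem chartAct_ofJet_smul (f : Γ(X, U)) (y : JetField K U) (m : Γ(M, U)) :
    C.chartAct c (AVLocal.ofJet K U (f • y)) m = f • C.chartAct c (AVLocal.ofJet K U y) m := by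
  rw [C.chartAct_ofJet, C.chartAct_ofJet]
  exact c.isFrame.jetOp_smul f y m

theorem chartAct_ofField_del (i : Fin n) (m : Γ(M, U)) :
    C.chartAct c (AVLocal.ofJet K U (Jet.ofField K Γ(X, U) (c.del i))) m =
      C.diffAct c (DiffOp.ofDerivation K (c.del i).toDerivation) m :=
  (C.chartAct_ofJet c _ m).trans (c.isFrame.jetOp_ofField_del i m)

/-- This is the formula for ρ. The jet 1 # f ∂_i is the Taylor series of f times ∂/∂X_i; its
constant term gives f (1 # ∂_i), and the tail is virtual. -/
theorem chartAct_ofField_smul_del (f : Γ(X, U)) (i : Fin n) (m : Γ(M, U)) :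
    C.chartAct c (AVLocal.ofJet K U (Jet.ofField K Γ(X, U) (f • c.del i))) m =
      f • C.diffAct c (DiffOp.ofDerivation K (c.del i).toDerivation) m +
        C.jetAct c.isAffineOpen
          (c.virtualJet (c.taylorTail f) (c.constantCoeff_taylorTail f) i) m := by
  have h : Jet.ofField K Γ(X, U) (f • c.del i) = f • Jet.ofField K Γ(X, U) (c.del i) +
      (c.virtualJet (c.taylorTail f) (c.constantCoeff_taylorTail f) i : JetField K U) := by
    change _ = _ + Jet.ofSeries c.x (taylor K c.del f - MvPowerSeries.C f) (c.del i)
    rw [Jet.ofSeries_sub, Jet.ofSeries_C, ← c.isFrame.ofSmash_smul_del]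
    exact (add_sub_cancel _ _).symm
  rw [h, map_add, map_add, LinearMap.add_apply, C.chartAct_ofJet_smul, C.chartAct_ofField_del,
    C.chartAct_ofJet_virtual]

theorem _root_.AVSheaf.JetField.res_ofField {W : X.Opens} (h : W ≤ U) (η : VectorField K U) :
    JetField.res K h (Jet.ofField K Γ(X, U) η) = Jet.ofField K Γ(X, W) (VectorField.res h η) := by
  refine AdicCompletion.ext fun k => ?_
  change Submodule.Quotient.mk (Smash.mk K (resFun K h 1) (VectorField.res h η)) =
    Submodule.Quotient.mk (Smash.mk K 1 (VectorField.res h η))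
  rw [map_one]

theorem _root_.AVSheaf.Jet.ofField_sum {ι : Type*} (s : Finset ι) (η : ι → VectorField K U) :
    Jet.ofField K Γ(X, U) (∑ j ∈ s, η j) = ∑ j ∈ s, Jet.ofField K Γ(X, U) (η j) := by
  simp only [Jet.ofField, ← map_sum]
  exact congrArg _ (TensorProduct.tmul_sum _ _ _)

/-- It suffices to treat generators. For functions and virtual jets this is the compatibility of the
given actions with restriction; for 1 # ∂_i it is the transition rule (2). -/
theorem chartAct_res {W : X.Opens} (h : W ≤ U) (d : EtaleChart K n W) (s : AVLocal K U)
    (m : Γ(M, U)) :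
    resMod h (C.chartAct c s m) = C.chartAct d (AVLocal.res K h s) (resMod h m) := by
  have hjet : ∀ (y : JetField K U) (m : Γ(M, U)),
      resMod h (C.chartAct c (AVLocal.ofJet K U y) m) =
        C.chartAct d (AVLocal.ofJet K W (JetField.res K h y)) (resMod h m) := by
    intro y m
    induction y using c.isFrame.jet_induction with
    | h0 l =>
      rw [C.chartAct_ofJet_virtual, C.jetAct_res c.isAffineOpen d.isAffineOpen h,
        ← C.chartAct_ofJet_virtual d]
      rfl
    | h1 i =>
      rw [C.chartAct_ofField_del, C.diffAct_trans h c d, JetField.res_ofField]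
      -- Expanded in the fields of the smaller chart, the restricted field acts by the formula for
      -- ρ, which is the right-hand side of the transition rule.
      conv_rhs => rw [← d.isFrame.sum_smul (VectorField.res h (c.del i))]
      rw [Jet.ofField_sum, map_sum, map_sum, LinearMap.sum_apply]
      refine Finset.sum_congr rfl fun j _ => ?_
      rw [C.chartAct_ofField_smul_del]
      rfl
    | hadd y z hy hz =>
      simp only [map_add, LinearMap.add_apply, resMod_add, hy, hz]
    | hsmul a y hy =>
      rw [C.chartAct_ofJet_smul, resMod_smul K, hy, ← C.chartAct_ofJet_smul]
      congr 3
      exact ((JetField.res K h).map_smul_apply a y).symm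
  have hfun : ∀ (f : Γ(X, U)) (m : Γ(M, U)),
      resMod h (C.chartAct c (AVLocal.ofFun K U f) m) =
        C.chartAct d (AVLocal.res K h (AVLocal.ofFun K U f)) (resMod h m) := by
    intro f m
    rw [C.chartAct_ofFun, AVLocal.res_ofFun, C.chartAct_ofFun, resMod_smul K]
  induction s using AVLocal.induction generalizing m with
  | hscalar r =>
    have := hfun (algebraMap K _ r) m
    rwa [AlgHom.commutes] at this
  | hfun f => exact hfun f m
  | hjet y => rw [hjet, AVLocal.res_ofJet]
  | hadd s t hs ht => simp only [map_add, LinearMap.add_apply, resMod_add, hs, ht]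
  | hmul s t hs ht => simp only [map_mul, Module.End.mul_apply, hs, ht]

end ChargedDModule
end ChartAction

/-! ### Gluing the chart actions. -/

section Gluing

variable {K : Type u} [Field K] {X : Scheme.{u}} [X.Over (Spec (CommRingCat.of K))]
  [IsIntegral X] {n : ℕ} [SmoothOfRelativeDimension n (X ↘ Spec (CommRingCat.of K))]
  {M : X.Modules}

variable (K n) in
/-- Sections agreeing on all étale charts are equal. -/
theorem eq_of_charts (W : X.Opens) (m m' : Γ(M, W))
    (h : ∀ (U : X.Opens) (hU : U ≤ W), Nonempty (EtaleChart K n U) → resMod hU m = resMod hU m') :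
    m = m' := by
  let F : TopCat.Sheaf Ab X := ⟨M.presheaf, M.isSheaf⟩
  refine F.eq_of_locally_eq'
    (fun U : {U : X.Opens // Nonempty (EtaleChart K n U) ∧ U ≤ W} => U.1) W
    (fun U => homOfLE U.2.2) (fun p hp => ?_) m m' fun U => h U.1 U.2.2 U.2.1
  obtain ⟨U, hpU, hUW, hc⟩ := exists_etaleChart (K := K) n W hp
  exact TopologicalSpace.Opens.mem_iSup.2 ⟨⟨U, hc, hUW⟩, hpU⟩

/-- Compatible families of sections on étale charts glue. -/
theorem exists_glue (W : X.Opens)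
    (t : ∀ U : {U : X.Opens // Nonempty (EtaleChart K n U) ∧ U ≤ W}, Γ(M, U.1))
    (ht : ∀ (U U' : {U : X.Opens // Nonempty (EtaleChart K n U) ∧ U ≤ W}) (h : U'.1 ≤ U.1),
      resMod h (t U) = t U') :
    ∃ m : Γ(M, W), ∀ U, resMod U.2.2 m = t U := by
  let F : TopCat.Sheaf Ab X := ⟨M.presheaf, M.isSheaf⟩
  obtain ⟨m, hm, -⟩ := F.existsUnique_gluing'
    (fun U : {U : X.Opens // Nonempty (EtaleChart K n U) ∧ U ≤ W} => U.1) W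
    (fun U => homOfLE U.2.2) (fun p hp => by
      obtain ⟨U, hpU, hUW, hc⟩ := exists_etaleChart (K := K) n W hp
      exact TopologicalSpace.Opens.mem_iSup.2 ⟨⟨U, hc, hUW⟩, hpU⟩) t (by
    intro U U'
    -- Compatibility is assumed only between nested charts, so the overlap is tested on the charts B
    -- inside it.
    refine eq_of_charts K n (U.1 ⊓ U'.1) _ _ fun B hB hc => ?_
    change resMod hB (resMod inf_le_left (t U)) = resMod hB (resMod inf_le_right (t U'))
    rw [resMod_resMod, resMod_resMod]
    exact (ht U ⟨B, hc, (hB.trans inf_le_left).trans U.2.2⟩ _).trans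
      (ht U' ⟨B, hc, (hB.trans inf_le_left).trans U.2.2⟩ _).symm)
  exact ⟨m, hm⟩

variable [CharZero K] [Smooth (X ↘ Spec (CommRingCat.of K))] (C : ChargedDModule K n M)

namespace ChargedDModule

theorem exists_act (W : X.Opens) (s : AV K n W) (m : Γ(M, W)) :
    ∃ m' : Γ(M, W), ∀ U, resMod U.2.2 m' = C.chartAct U.2.1.some (s.1 U) (resMod U.2.2 m) := by
  refine exists_glue W (fun U => C.chartAct U.2.1.some (s.1 U) (resMod U.2.2 m)) fun U B h => ?_
  rw [C.chartAct_res _ h B.2.1.some, resMod_resMod, s.2 U B h]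

/-- The action of a section of `AV` on sections. -/
def actFun (W : X.Opens) (s : AV K n W) (m : Γ(M, W)) : Γ(M, W) :=
  (C.exists_act W s m).choose

/-- Independence of the chosen coordinates: compatibility with restriction, applied to U inside
itself with two coordinate systems, shows that both give the same action. -/
theorem resMod_actFun {W U : X.Opens} (s : AV K n W) (m : Γ(M, W)) (c : EtaleChart K n U)
    (h : U ≤ W) : resMod h (C.actFun W s m) = C.chartAct c (s.1 ⟨U, ⟨c⟩, h⟩) (resMod h m) := by
  let U' : {U : X.Opens // Nonempty (EtaleChart K n U) ∧ U ≤ W} := ⟨U, ⟨c⟩, h⟩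
  have h1 : resMod h (C.actFun W s m) = C.chartAct U'.2.1.some (s.1 U') (resMod h m) :=
    (C.exists_act W s m).choose_spec U'
  have h2 := C.chartAct_res U'.2.1.some (le_refl U) c (s.1 U') (resMod h m)
  rw [resMod_self, resMod_self, s.2 U' U' le_rfl] at h2
  exact h1.trans h2

/-- The structure of a module over `AV` on a charged `D`-module. -/
def toAVModule : AVModule K n M where
  act W :=
    { toFun := fun s => AddMonoidHom.mk' (C.actFun W s) fun m m' =>
        -- Here and below, each axiom is checked after restriction to charts, where it holds for the
        -- chart action.
        eq_of_charts K n W _ _ fun U hU ⟨c⟩ => by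
          simp only [resMod_add, C.resMod_actFun _ _ c, map_add]
      map_one' := AddMonoidHom.ext fun m => eq_of_charts K n W _ _ fun U hU ⟨c⟩ => by
        refine (C.resMod_actFun 1 m c hU).trans ?_
        have : (1 : AV K n W).1 ⟨U, ⟨c⟩, hU⟩ = 1 := rfl
        rw [this, map_one]
        rfl
      map_mul' := fun s t => AddMonoidHom.ext fun m => eq_of_charts K n W _ _ fun U hU ⟨c⟩ => by
        change resMod hU (C.actFun W (s * t) m) = resMod hU (C.actFun W s (C.actFun W t m))
        have : (s * t).1 ⟨U, ⟨c⟩, hU⟩ = s.1 ⟨U, ⟨c⟩, hU⟩ * t.1 ⟨U, ⟨c⟩, hU⟩ := rfl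
        rw [C.resMod_actFun _ _ c, C.resMod_actFun _ _ c, C.resMod_actFun _ _ c, this, map_mul,
          Module.End.mul_apply]
      map_zero' := AddMonoidHom.ext fun m => eq_of_charts K n W _ _ fun U hU ⟨c⟩ => by
        refine (C.resMod_actFun 0 m c hU).trans ?_
        have : (0 : AV K n W).1 ⟨U, ⟨c⟩, hU⟩ = 0 := rfl
        rw [this, map_zero]
        exact (resMod_zero hU).symm
      map_add' := fun s t => AddMonoidHom.ext fun m => eq_of_charts K n W _ _ fun U hU ⟨c⟩ => by
        change resMod hU (C.actFun W (s + t) m) = resMod hU (C.actFun W s m + C.actFun W t m)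
        have : (s + t).1 ⟨U, ⟨c⟩, hU⟩ = s.1 ⟨U, ⟨c⟩, hU⟩ + t.1 ⟨U, ⟨c⟩, hU⟩ := rfl
        rw [resMod_add, C.resMod_actFun _ _ c, C.resMod_actFun _ _ c, C.resMod_actFun _ _ c, this,
          map_add, LinearMap.add_apply] }
  act_fun W f m := eq_of_charts K n W _ _ fun U hU ⟨c⟩ => by
    refine (C.resMod_actFun _ m c hU).trans ?_
    rw [resMod_smul K]
    exact C.chartAct_ofFun c _ _
  act_res {W W'} h s m := eq_of_charts K n W' _ _ fun U hU ⟨c⟩ => by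
    change resMod hU (resMod h (C.actFun W s m)) =
      resMod hU (C.actFun W' (AV.res K n h s) (resMod h m))
    rw [resMod_resMod, C.resMod_actFun _ _ c, C.resMod_actFun _ _ c, resMod_resMod]
    rfl

theorem toAVModule_act {U : X.Opens} (c : EtaleChart K n U) (s : AV K n U) (m : Γ(M, U)) :
    C.toAVModule.act U s m = C.chartAct c (s.1 ⟨U, ⟨c⟩, le_rfl⟩) m := by
  have := C.resMod_actFun s m c le_rfl
  rwa [resMod_self, resMod_self] at this

theorem toAVModule_act_ofJet {U : X.Opens} (c : EtaleChart K n U) (y : JetField K U)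
    (m : Γ(M, U)) :
    C.toAVModule.act U (AV.ofJet K n y) m = C.chartAct c (AVLocal.ofJet K U y) m := by
  rw [C.toAVModule_act c]
  -- The component on U of the section attached to y involves the restriction of y from U to itself;
  -- it is checked to be the identity on representatives at each level.
  have : JetField.res K (le_refl U) y = y := by
    refine AdicCompletion.ext fun k => ?_
    obtain ⟨a, ha⟩ := Jet.exists_rep y k
    refine (congrArg (Smash.quotMap (VectorField.res (le_refl U)) k) ha).trans ?_
    rw [Smash.quotMap_mk, ha]
    congr 1
    clear ha
    induction a using Smash.induction with
    | h0 => rw [map_zero]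
    | h2 a b h h' => rw [map_add, h, h']
    | h1 f η =>
      rw [Smash.map_mk, resFun_self]
      rfl
  change C.chartAct c (AVLocal.ofJet K U (JetField.res K (le_refl U) y)) m = _
  rw [this]

end ChargedDModule
end Gluing

end AVSheaf

end

theorem theorem15 {K : Type u} [Field K] [IsAlgClosed K] [CharZero K]
    {X : Scheme.{u}} [X.Over (Spec (CommRingCat.of K))] [IsIntegral X] (n : ℕ)
    [SmoothOfRelativeDimension n (X ↘ Spec (CommRingCat.of K))]
    (hX : IsQuasiProjective K X) (M : X.Modules) (C : ChargedDModule K n M) :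
    ∃ N : AVModule K n M,
      (∀ (U : X.Opens) (c : EtaleChart K n U) (l : VirtualJetField K U) (m : Γ(M, U)),
        N.act U (AV.ofJet K n (l : JetField K U)) m = C.jetAct c.isAffineOpen l m) ∧
      ∀ (U : X.Opens) (c : EtaleChart K n U) (f : Γ(X, U)) (i : Fin n) (m : Γ(M, U)),
        N.act U (AV.ofVectorField K n (f • c.del i)) m =
          f • C.diffAct c (DiffOp.ofDerivation K (c.del i).toDerivation) m +
          C.jetAct c.isAffineOpen
            (c.virtualJet (c.taylorTail f) (c.constantCoeff_taylorTail f) i) m := by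
  have := SmoothOfRelativeDimension.smooth n (X ↘ Spec (CommRingCat.of K))
  exact ⟨C.toAVModule,
    fun U c l m => (C.toAVModule_act_ofJet c l m).trans (C.chartAct_ofJet_virtual c l m),
    fun U c f i m => (C.toAVModule_act_ofJet c _ m).trans (C.chartAct_ofField_smul_del c f i m)⟩
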